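/- All manifolds and maps are smooth ($C^\infty$) and real. **Definitions.** A *pseudocomplex structure* on a 4-manifold $M$ is a 6-manifold $E$ with a submersion $p\colon E\to M$ and a smooth map $e\mapsto P_e\subset T_{p(e)}M$ to the bundle of 2-planes in the tangent spaces of $M$, such that the fibres $E_m=p^{-1}(m)\to \mathrm{Gr}_2(T_mM)$ are immersed elliptic line congruences: for every nonzero vector $w$ tangent to the fibre at $e$, the derivative of $P$ along $w$, a linear map $P_e\to T_{p(e)}M/P_e$, is injective. (So $E$ is an immersed submanifold of the Grassmann bundle; it is not required to be embedded or proper over $M$. The 2-planes are not oriented; an orientation can be chosen locally and plays no role below.) A *4-parameter family of $E$ curves* on a 4-manifold $X$ with pseudocomplex structure $(E,p,P)$ consists of a 4-manifold $Y$ (the parameters), a 6-manifold $Z$ (the pointed curves), a submersion $\rho\colon Z\to Y$ (forget the point) and a map $\lambda\colon Z\to X$ (forget the curve), such that for every $z\in Z$ the plane $\lambda_*(\ker \rho_{*,z})$, the tangent plane at $z$ of the curve $\lambda|_{\rho^{-1}(\rho(z))}$, is the plane of a point $\tau(z)\in E$ over $\lambda(z)$, where $\tau\colon Z\to E$ is a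 local diffeomorphism. Let $\Theta_z=\lambda_{*,z}^{-1}(P_{\tau(z)})\subset T_zZ$. The *dual structure* on $Y$ is given by $\rho\colon Z\to Y$ and the planes $P'_z=\rho_*(\Theta_z)=\rho_*(\ker\lambda_{*,z})\subset T_{\rho(z)}Y$. (In terms of adapted coframings $(\theta,\omega,\pi)$ of $Z$, for which $\Theta$ is $\theta=0$, the fibres of $\lambda$ are $\theta=\omega=0$ and those of $\rho$ are $\theta=\pi=0$, it is the structure of the coframings $(\theta',\omega',\pi')=(\theta,\pi,-\omega)$.) **Theorem.** Let $Y$ be a 4-parameter family of $E$ curves on a 4-manifold $X$ with a pseudocomplex structure, with pointed curves $Z$ as above. 1. The dual structure $(Z,\rho,P')$ is a pseudocomplex structure on $Y$. 2. Let $U\subset Z$ be open, and suppose that over $U$ the structure given by $Z$ is almost complex both on $X$ and on $Y$: there are smooth almost complex structures $J_X$ on the open set $\lambda(U)\subset X$ and $J_Y$ on the open set $\rho(U)\subset Y$ such that for every $z\in U$ the plane $P_{\tau(z)}$ is a $J_X$-complex line and the plane $P'_z$ is a $J_Y$-complex line. Then $J_X$ and $J_Y$ are complex structures: around every point of $\lambda(U)$,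 and around every point of $\rho(U)$, there is a local diffeomorphism $\varphi$ to $\mathbb C^2$ with $d\varphi\circ J=i\,d\varphi$. In particular both pseudocomplex structures are then locally equivalent to the flat one, that of the complex lines in $\mathbb C^2$. -/

import Mathlib

open scoped Manifold ContDiff Topology

/-- The model space of real 4-manifolds. -/
abbrev R4 : Type := EuclideanSpace ℝ (Fin 4)

/-- The model space of real 6-manifolds. -/
abbrev R6 : Type := EuclideanSpace ℝ (Fin 6)

noncomputable section

section Pseudocomplex

variable {M : Type*} [TopologicalSpace M] [ChartedSpace R4 M] [IsManifold (𝓡 4) ∞ M]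
variable {E : Type*} [TopologicalSpace E] [ChartedSpace R6 E] [IsManifold (𝓡 6) ∞ E]

/-- `s` is a smooth section, along `p : E → M` and over the set `U`, of the field of subspaces
`P e ⊆ T_{p e} M`. -/
def IsSmoothSectionOn (p : E → M) (P : ∀ e, Submodule ℝ (TangentSpace (𝓡 4) (p e)))
    (s : ∀ e, TangentSpace (𝓡 4) (p e)) (U : Set E) : Prop :=
  ContMDiffOn (𝓡 6) (𝓡 4).tangent ∞ (fun e => (⟨p e, s e⟩ : TangentBundle (𝓡 4) M)) U ∧
    ∀ e ∈ U, s e ∈ P e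

/-- `P` is a smooth field of 2-planes `P e ⊆ T_{p e} M`, i.e. `e ↦ (p e, P e)` is a smooth map
from `E` to the bundle of 2-planes in the tangent spaces of `M`: locally `P` is spanned by two
smooth linearly independent sections. -/
def IsSmoothPlaneField (p : E → M) (P : ∀ e, Submodule ℝ (TangentSpace (𝓡 4) (p e))) : Prop :=
  ∀ e₀ : E, ∃ U : Set E, IsOpen U ∧ e₀ ∈ U ∧
    ∃ s t : ∀ e, TangentSpace (𝓡 4) (p e),
      IsSmoothSectionOn p P s U ∧ IsSmoothSectionOn p P t U ∧
      ∀ e ∈ U, LinearIndependent ℝ ![s e, t e] ∧ Submodule.span ℝ {s e, t e} = P e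

/-- The derivative at `e₀`, in the direction of a vector `w` tangent to the fibre of `p`, of a
section `s` of the pulled back tangent bundle `p^* TM`. Along the fibre of `p` through `e₀` the
section takes values in the fixed vector space `T_{p e₀} M`, so the derivative is an element of
that space. It is computed in the trivialization of `TM` centred at `p e₀` (which is the identity
on `T_{p e₀} M`), and for `w ∈ ker dp` it does not depend on the trivialization. -/
def vertDeriv (p : E → M) (s : ∀ e, TangentSpace (𝓡 4) (p e)) (e₀ : E)
    (w : TangentSpace (𝓡 6) e₀) : TangentSpace (𝓡 4) (p e₀) :=
  mfderiv (𝓡 6) 𝓘(ℝ, R4)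
    (fun e => ((trivializationAt R4 (TangentSpace (𝓡 4) : M → Type _) (p e₀))
      (⟨p e, s e⟩ : TangentBundle (𝓡 4) M)).2) e₀ w

/-- The map from the fibres of `p` to the Grassmannians of 2-planes, `e ↦ P e ⊆ T_m M`, is an
immersed elliptic line congruence: the derivative of `P` along a nonzero vertical vector `w`,
which is the linear map `P e₀ → T_m M / P e₀`, `s e₀ ↦ vertDeriv p s e₀ w mod P e₀`
(for sections `s` of `P`), is neither zero nor of rank one, that is, it is injective. -/
def IsEllipticFamily (p : E → M) (P : ∀ e, Submodule ℝ (TangentSpace (𝓡 4) (p e))) : Prop :=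
  ∀ (e₀ : E) (w : TangentSpace (𝓡 6) e₀), mfderiv (𝓡 6) (𝓡 4) p e₀ w = 0 → w ≠ 0 →
    ∀ (s : ∀ e, TangentSpace (𝓡 4) (p e)) (U : Set E), IsOpen U → e₀ ∈ U →
      IsSmoothSectionOn p P s U → s e₀ ≠ 0 → vertDeriv p s e₀ w ∉ P e₀

/-- A pseudocomplex structure on the 4-manifold `M`: a 6-manifold `E` with a submersion
`p : E → M` and a smooth map `e ↦ (p e, P e)` over `M` to the bundle of 2-planes in the tangent
spaces of `M`, whose fibres over `M` are immersed elliptic line congruences. (Then `E` is an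
immersed submanifold of the Grassmann bundle. Neither injectivity nor properness is asked for.) -/
structure IsPseudocomplex (p : E → M) (P : ∀ e, Submodule ℝ (TangentSpace (𝓡 4) (p e))) :
    Prop where
  contMDiff : ContMDiff (𝓡 6) (𝓡 4) ∞ p
  submersion : ∀ e, Function.Surjective (mfderiv (𝓡 6) (𝓡 4) p e)
  smooth_planes : IsSmoothPlaneField p P
  elliptic : IsEllipticFamily p P

/-- `J` is a (smooth) almost complex structure on the subset `W` of `M` (meant for open `W`). -/
structure IsAlmostComplexStructureOn
    (J : ∀ x : M, TangentSpace (𝓡 4) x →L[ℝ] TangentSpace (𝓡 4) x) (W : Set M) : Prop where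
  smooth : ContMDiffOn (𝓡 4) ((𝓡 4).prod 𝓘(ℝ, R4 →L[ℝ] R4)) ∞
    (fun x => Bundle.TotalSpace.mk' (R4 →L[ℝ] R4)
      (E := fun x : M => TangentSpace (𝓡 4) x →L[ℝ] TangentSpace (𝓡 4) x) x (J x)) W
  sq_eq_neg_one : ∀ x ∈ W, ∀ v : TangentSpace (𝓡 4) x, J x (J x v) = -v

/-- The derivative of a `ℂ × ℂ`-valued function on a 4-manifold. -/
def coordDeriv (φ : M → ℂ × ℂ) (x : M) : TangentSpace (𝓡 4) x →L[ℝ] ℂ × ℂ :=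
  mfderiv (𝓡 4) 𝓘(ℝ, ℂ × ℂ) φ x

/-- `J` is a complex structure on the subset `W` of `M` (meant for open `W`): it is an almost
complex structure for which there are local holomorphic coordinates with values in `ℂ × ℂ` around
each point of `W`. -/
def IsComplexStructureOn
    (J : ∀ x : M, TangentSpace (𝓡 4) x →L[ℝ] TangentSpace (𝓡 4) x) (W : Set M) : Prop :=
  IsAlmostComplexStructureOn J W ∧
    ∀ x ∈ W, ∃ φ : M → ℂ × ℂ,
      IsLocalDiffeomorphAt (𝓡 4) 𝓘(ℝ, ℂ × ℂ) ∞ φ x ∧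
      ∀ᶠ x' in 𝓝 x, ∀ v : TangentSpace (𝓡 4) x',
        coordDeriv φ x' (J x' v) = Complex.I • coordDeriv φ x' v

/-- Over the open part `U` of `E`, the pseudocomplex structure `(p, P)` is the almost complex
structure `J`: the planes `P e` are complex lines of `J`. (By dimension count, `U` is then mapped
onto an immersed open part of the bundle of complex lines of `J`.) -/
def IsAlmostComplexOver (p : E → M) (P : ∀ e, Submodule ℝ (TangentSpace (𝓡 4) (p e)))
    (U : Set E) (J : ∀ x : M, TangentSpace (𝓡 4) x →L[ℝ] TangentSpace (𝓡 4) x) : Prop :=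
  IsAlmostComplexStructureOn J (p '' U) ∧ ∀ e ∈ U, ∀ v ∈ P e, J (p e) v ∈ P e

end Pseudocomplex

section Dual

variable {X : Type*} [TopologicalSpace X] [ChartedSpace R4 X] [IsManifold (𝓡 4) ∞ X]
variable {E : Type*} [TopologicalSpace E] [ChartedSpace R6 E] [IsManifold (𝓡 6) ∞ E]
variable {Y : Type*} [TopologicalSpace Y] [ChartedSpace R4 Y] [IsManifold (𝓡 4) ∞ Y]
variable {Z : Type*} [TopologicalSpace Z] [ChartedSpace R6 Z] [IsManifold (𝓡 6) ∞ Z]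

/-- The map `Z → X` forgetting the curve of a pointed curve; `τ` sends the pointed curve `(x, C)`
to the point of `E` given by the plane `T_x C`, and `p : E → X` is the projection. -/
def pointMap (p : E → X) (τ : Z → E) : Z → X := fun z => p (τ z)

/-- The planes `T_x C ⊆ T_x X` at the pointed curves `z = (x, C)`. -/
def curvePlane (p : E → X) (P : ∀ e, Submodule ℝ (TangentSpace (𝓡 4) (p e))) (τ : Z → E) (z : Z) :
    Submodule ℝ (TangentSpace (𝓡 4) (pointMap p τ z)) :=
  P (τ z)

/-- A 4-parameter family of curves of the pseudocomplex structure `(p, P)` on `X`, with parameter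
manifold `Y` and manifold of pointed curves `Z`. The map `ρ : Z → Y` forgets the point, the map
`pointMap p τ : Z → X` forgets the curve; the curve with parameter `y` is the fibre `ρ ⁻¹ {y}`,
mapped to `X` by `pointMap p τ`, and its tangent plane at each point `z` is the plane of `E` at
`τ z`. The map `τ : Z → E` is a local diffeomorphism. -/
structure IsCurveFamily (p : E → X) (P : ∀ e, Submodule ℝ (TangentSpace (𝓡 4) (p e)))
    (τ : Z → E) (ρ : Z → Y) : Prop where
  contMDiff : ContMDiff (𝓡 6) (𝓡 4) ∞ ρ
  submersion : ∀ z, Function.Surjective (mfderiv (𝓡 6) (𝓡 4) ρ z)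
  tangent : ∀ z, (LinearMap.ker (mfderiv (𝓡 6) (𝓡 4) ρ z).toLinearMap).map
    (mfderiv (𝓡 6) (𝓡 4) (pointMap p τ) z).toLinearMap = curvePlane p P τ z
  localDiffeo : IsLocalDiffeomorph (𝓡 6) (𝓡 6) ∞ τ

/-- The 4-plane field `Θ` on `Z`: the preimage of the plane `T_x C` under the derivative of
`Z → X`. It is the field of 4-planes `θ = 0` for any adapted coframing `θ, ω, π`. -/
def contactPlane (p : E → X) (P : ∀ e, Submodule ℝ (TangentSpace (𝓡 4) (p e))) (τ : Z → E)
    (z : Z) : Submodule ℝ (TangentSpace (𝓡 6) z) :=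
  (curvePlane p P τ z).comap (mfderiv (𝓡 6) (𝓡 4) (pointMap p τ) z).toLinearMap

/-- The plane field of the dual structure on `Y`. For adapted coframings, where the fibres of
`Z → X` are `θ = ω = 0` and those of `Z → Y` are `θ = π = 0`, the dual structure has the coframing
`(θ', ω', π') = (θ, π, -ω)`. So its 4-plane field `θ' = 0` is the same field `Θ`, its base is `Y`,
and its plane at `z` is the image of `Θ` in the tangent space of `Y`. -/
def dualPlane (p : E → X) (P : ∀ e, Submodule ℝ (TangentSpace (𝓡 4) (p e))) (τ : Z → E)
    (ρ : Z → Y) (z : Z) : Submodule ℝ (TangentSpace (𝓡 4) (ρ z)) :=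
  (contactPlane p P τ z).map (mfderiv (𝓡 6) (𝓡 4) ρ z).toLinearMap

end Dual

end

/-! Everything happens on `Z`, through a transverse pair of submersions: L to the points and R to
the curves, both with 2-dimensional kernels. The variation of the planes dL(ker dR) along a fibre of
L is the bracket pairing of ker dR and ker dL with values in the real plane Q = TZ/(ker dL + ker dR)
(`fderiv_section_sub_mem`). Ellipticity says that nonzero vectors have nonzero pairing. Exchanging L
and R only changes the sign of the pairing (`EllipticAt.symm`), so the dual structure is elliptic
too.

Now let both sides be almost complex. Q is identified with TX/P and with TY/P', and so carries two
complex structures. Along a fibre of L the endomorphism given by `JX` is constant, so the pairing is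
complex linear in ker dR for the first structure; likewise it is complex linear in ker dL for the
second. Since the pairing with a fixed nonzero vector is onto Q, the two structures commute, and in
real dimension two they agree up to a sign ε (`exists_sign_of_complexLinear_pairing`), which is
locally constant (`eventually_isSignAt`).

Holomorphic functions come from pencils of curves. Take a curve through x₀ and a second pointed
position on it, over x₁. Each x near x₀ is joined to x₁ by a locally unique curve near the given one
(`exists_pencil`); let f(x) be its tangent line at x₁, a point of the projective line of complex
lines in the tangent space at x₁. Both the passage from x to the curve and that from the curve to
its tangent line are complex linear to first order for ε times the structure on Y, so f is
holomorphic. Its differential at x₀ vanishes at most on the tangent plane of the curve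
(`exists_holomorphic_function`). Two curves through x₀ with transverse tangent planes give
coordinates (`exists_holomorphic_coordinates`). The argument is symmetric in points and curves. What
remains is the translation between manifolds and charts. -/

set_option linter.unusedSectionVars false

noncomputable section

/-! ### Linear algebra of complex lines in a real vector space. -/

section ComplexLines

variable {V : Type*} [AddCommGroup V] [Module ℝ V]

/-- Since j² = -1, a relation a s + b j s = 0 gives (a² + b²) s = 0. Hence s and j s are independent
and form a basis of the plane. -/
theorem exists_eq_smul_add_smul_of_mem_complexLine (j : V →ₗ[ℝ] V) (P : Submodule ℝ V)
    (hj : ∀ v, j (j v) = -v) (hP : ∀ v ∈ P, j v ∈ P) (hfin : Module.finrank ℝ P = 2)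
    {s : V} (hs : s ∈ P) (hs0 : s ≠ 0) {u : V} (hu : u ∈ P) :
    ∃ a b : ℝ, u = a • s + b • j s := by
  have hli : LinearIndependent ℝ ![(⟨s, hs⟩ : P), ⟨j s, hP s hs⟩] := by
    rw [LinearIndependent.pair_iff]
    intro a b hab
    have h1 : a • s + b • j s = 0 := by simpa using congrArg Subtype.val hab
    have h2 : a • j s - b • s = 0 := by
      have := congrArg j h1
      simpa [hj, sub_eq_add_neg] using this
    have h3 : (a * a + b * b) • s = 0 := by
      have : (a * a + b * b) • s = a • (a • s + b • j s) - b • (a • j s - b • s) := by module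
      rw [this, h1, h2]; simp
    have h4 : a * a + b * b = 0 := by simpa [hs0] using h3
    constructor <;> nlinarith [mul_self_nonneg a, mul_self_nonneg b]
  have htop := hli.span_eq_top_of_card_eq_finrank (by simp [hfin])
  have hmem : (⟨u, hu⟩ : P) ∈ Submodule.span ℝ (Set.range ![(⟨s, hs⟩ : P), ⟨j s, hP s hs⟩]) := by
    rw [htop]; trivial
  rw [Matrix.range_cons, Matrix.range_cons, Matrix.range_empty, Set.union_empty,
    Set.singleton_union, Submodule.mem_span_pair] at hmem
  obtain ⟨a, b, h⟩ := hmem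
  exact ⟨a, b, by simpa using (congrArg Subtype.val h).symm⟩

theorem complexLine_le_of_mem (j : V →ₗ[ℝ] V) (P P' : Submodule ℝ V)
    (hj : ∀ v, j (j v) = -v) (hP : ∀ v ∈ P, j v ∈ P) (hfin : Module.finrank ℝ P = 2)
    (hP' : ∀ v ∈ P', j v ∈ P') {s : V} (hs : s ∈ P) (hs' : s ∈ P') (hs0 : s ≠ 0) : P ≤ P' := by
  intro u hu
  obtain ⟨a, b, rfl⟩ := exists_eq_smul_add_smul_of_mem_complexLine j P hj hP hfin hs hs0 hu
  exact P'.add_mem (P'.smul_mem _ hs') (P'.smul_mem _ (hP' _ hs'))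

/-- Gives the dichotomy used along the fibres: two complex lines coincide or meet only in 0. -/
theorem complexLine_eq_of_mem (j : V →ₗ[ℝ] V) (P P' : Submodule ℝ V)
    (hj : ∀ v, j (j v) = -v) (hP : ∀ v ∈ P, j v ∈ P) (hfin : Module.finrank ℝ P = 2)
    (hP' : ∀ v ∈ P', j v ∈ P') (hfin' : Module.finrank ℝ P' = 2)
    {s : V} (hs : s ∈ P) (hs' : s ∈ P') (hs0 : s ≠ 0) : P = P' :=
  le_antisymm (complexLine_le_of_mem j P P' hj hP hfin hP' hs hs' hs0)
    (complexLine_le_of_mem j P' P hj hP' hfin' hP hs' hs hs0)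

/-- Commutation gives (J + K)(J - K) = J² - K² = 0. If some s = J q - K q is nonzero, then s and J s
span the plane, and J + K kills both. -/
theorem eq_or_eq_neg_of_commute_of_finrank_eq_two (J K : V →ₗ[ℝ] V) (hJ : ∀ v, J (J v) = -v)
    (hK : ∀ v, K (K v) = -v) (hJK : ∀ v, J (K v) = K (J v)) (hfin : Module.finrank ℝ V = 2) :
    (∀ v, J v = K v) ∨ ∀ v, J v = -K v := by
  by_contra! h
  obtain ⟨⟨q, hq⟩, u, hu⟩ := h
  apply hu
  obtain ⟨a, b, rfl⟩ := exists_eq_smul_add_smul_of_mem_complexLine J ⊤ hJ (by simp)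
    (by simpa using hfin) (s := J q - K q) (by simp) (sub_ne_zero.2 hq) (u := u) (by simp)
  simp only [map_add, map_smul, map_sub, hJ, hK, hJK, map_neg]
  module

end ComplexLines

/-! ### Pointwise algebra of a transverse pair and its pairing. -/

section TransversePair

variable {T A B : Type*} [AddCommGroup T] [Module ℝ T] [AddCommGroup A] [Module ℝ A]
  [AddCommGroup B] [Module ℝ B]

theorem map_mem_map_ker_iff (f : T →ₗ[ℝ] A) (g : T →ₗ[ℝ] B) (u : T) :
    f u ∈ (LinearMap.ker g).map f ↔ u ∈ LinearMap.ker f ⊔ LinearMap.ker g := by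
  rw [← Submodule.mem_comap, Submodule.comap_map_eq, sup_comm]

theorem map_mem_map_ker_iff' (f : T →ₗ[ℝ] A) (g : T →ₗ[ℝ] B) (u : T) :
    g u ∈ (LinearMap.ker f).map g ↔ u ∈ LinearMap.ker f ⊔ LinearMap.ker g := by
  rw [map_mem_map_ker_iff, sup_comm]

variable [FiniteDimensional ℝ T]

theorem finrank_ker_of_surjective (f : T →ₗ[ℝ] A) (hf : Function.Surjective f)
    (hT : Module.finrank ℝ T = 6) (hA : Module.finrank ℝ A = 4) :
    Module.finrank ℝ (LinearMap.ker f) = 2 := by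
  have := f.finrank_range_add_finrank_ker
  rw [LinearMap.range_eq_top.2 hf, finrank_top] at this
  omega

theorem exists_ker_ne_zero (f : T →ₗ[ℝ] A) (hf : Function.Surjective f)
    (hT : Module.finrank ℝ T = 6) (hA : Module.finrank ℝ A = 4) : ∃ v, f v = 0 ∧ v ≠ 0 := by
  have : Nontrivial (LinearMap.ker f) := by
    apply Module.nontrivial_of_finrank_pos (R := ℝ)
    rw [finrank_ker_of_surjective f hf hT hA]; norm_num
  obtain ⟨⟨v, hv⟩, hv0⟩ := exists_ne (0 : LinearMap.ker f)
  exact ⟨v, hv, fun h => hv0 (Subtype.ext h)⟩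

theorem finrank_map_ker (f : T →ₗ[ℝ] A) (g : T →ₗ[ℝ] B)
    (hg : Function.Surjective g) (hT : Module.finrank ℝ T = 6)
    (hB : Module.finrank ℝ B = 4) (htr : ∀ u, f u = 0 → g u = 0 → u = 0) :
    Module.finrank ℝ ((LinearMap.ker g).map f) = 2 := by
  rw [← finrank_ker_of_surjective g hg hT hB]
  have hinj : Function.Injective (f.domRestrict (LinearMap.ker g)) := by
    rw [← LinearMap.ker_eq_bot, LinearMap.ker_eq_bot']
    rintro ⟨u, hu⟩ h
    exact Subtype.ext (htr u h hu)
  have := LinearMap.finrank_range_of_inj hinj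
  rwa [LinearMap.range_domRestrict] at this

theorem finrank_quotient_ker_sup_ker (f : T →ₗ[ℝ] A) (g : T →ₗ[ℝ] B)
    (hf : Function.Surjective f) (hg : Function.Surjective g) (hT : Module.finrank ℝ T = 6)
    (hA : Module.finrank ℝ A = 4) (hB : Module.finrank ℝ B = 4)
    (htr : ∀ u, f u = 0 → g u = 0 → u = 0) :
    Module.finrank ℝ (T ⧸ (LinearMap.ker f ⊔ LinearMap.ker g)) = 2 := by
  have h1 := Submodule.finrank_sup_add_finrank_inf_eq (LinearMap.ker f) (LinearMap.ker g)
  have h2 : LinearMap.ker f ⊓ LinearMap.ker g = ⊥ := by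
    rw [eq_bot_iff]
    rintro u ⟨h, h'⟩
    exact htr u h h'
  rw [h2, finrank_bot, finrank_ker_of_surjective f hf hT hA,
    finrank_ker_of_surjective g hg hT hB] at h1
  have h3 := Submodule.finrank_quotient_add_finrank (LinearMap.ker f ⊔ LinearMap.ker g)
  omega

/-- The complex structures induced on `T / (ker f + ker g)` from both factors of a transverse pair
agree up to sign, provided that the pairing `c` is complex linear in either variable. -/
theorem exists_sign_of_complexLinear_pairing (f : T →ₗ[ℝ] A) (g : T →ₗ[ℝ] B)
    (hf : Function.Surjective f) (hg : Function.Surjective g) (hT : Module.finrank ℝ T = 6)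
    (hA : Module.finrank ℝ A = 4) (hB : Module.finrank ℝ B = 4)
    (htr : ∀ u, f u = 0 → g u = 0 → u = 0) (c : T →ₗ[ℝ] T →ₗ[ℝ] T)
    (hc : ∀ v w, g v = 0 → f w = 0 → v ≠ 0 → w ≠ 0 →
      c v w ∉ LinearMap.ker f ⊔ LinearMap.ker g)
    (j : A →ₗ[ℝ] A) (k : B →ₗ[ℝ] B) (hj : ∀ a, j (j a) = -a) (hk : ∀ b, k (k b) = -b)
    (hjP : ∀ v, g v = 0 → j (f v) ∈ (LinearMap.ker g).map f)
    (hkP : ∀ w, f w = 0 → k (g w) ∈ (LinearMap.ker f).map g)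
    (hcj : ∀ v v' w, g v = 0 → g v' = 0 → f v' = j (f v) → f w = 0 →
      f (c v' w) - j (f (c v w)) ∈ (LinearMap.ker g).map f)
    (hck : ∀ w w' v, f w = 0 → f w' = 0 → g w' = k (g w) → g v = 0 →
      g (c v w') - k (g (c v w)) ∈ (LinearMap.ker f).map g) :
    ∃ ε : ℝ, (ε = 1 ∨ ε = -1) ∧ ∀ u u', f u' = j (f u) →
      g u' - ε • k (g u) ∈ (LinearMap.ker f).map g := by
  set Θ := LinearMap.ker f ⊔ LinearMap.ker g with hΘ
  -- Right inverses carry `j` and `k` back to `T`. A different choice changes the result only by an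
  -- element of ker f or ker g, so the induced maps on the quotient by `Θ` are canonical.
  obtain ⟨sf, hsf⟩ := f.exists_rightInverse_of_surjective (LinearMap.range_eq_top.2 hf)
  obtain ⟨sg, hsg⟩ := g.exists_rightInverse_of_surjective (LinearMap.range_eq_top.2 hg)
  replace hsf : ∀ a, f (sf a) = a := fun a => LinearMap.congr_fun hsf a
  replace hsg : ∀ a, g (sg a) = a := fun a => LinearMap.congr_fun hsg a
  have hQ := finrank_quotient_ker_sup_ker f g hf hg hT hA hB htr
  have hjΘ : Θ ≤ Θ.comap (sf ∘ₗ j ∘ₗ f) := by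
    intro u hu
    obtain ⟨w, hw, v, hv, rfl⟩ := Submodule.mem_sup.1 hu
    have hw' : f w = 0 := hw
    rw [Submodule.mem_comap, hΘ, ← map_mem_map_ker_iff]
    simpa [hsf, hw'] using hjP v hv
  have hkΘ : Θ ≤ Θ.comap (sg ∘ₗ k ∘ₗ g) := by
    intro u hu
    obtain ⟨w, hw, v, hv, rfl⟩ := Submodule.mem_sup.1 hu
    have hv' : g v = 0 := hv
    rw [Submodule.mem_comap, hΘ, ← map_mem_map_ker_iff']
    simpa [hsg, hv'] using hkP w hw
  set J := Θ.mapQ Θ _ hjΘ with hJ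
  set K := Θ.mapQ Θ _ hkΘ with hK
  have hJJ : ∀ q, J (J q) = -q := by
    intro q
    obtain ⟨u, rfl⟩ := Θ.mkQ_surjective q
    simp only [hJ, Submodule.mkQ_apply, Submodule.mapQ_apply, ← Submodule.Quotient.mk_neg]
    rw [Submodule.Quotient.eq]
    refine Submodule.mem_sup_left ?_
    simp [hsf, hj]
  have hKK : ∀ q, K (K q) = -q := by
    intro q
    obtain ⟨u, rfl⟩ := Θ.mkQ_surjective q
    simp only [hK, Submodule.mkQ_apply, Submodule.mapQ_apply, ← Submodule.Quotient.mk_neg]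
    rw [Submodule.Quotient.eq]
    refine Submodule.mem_sup_right ?_
    simp [hsg, hk]
  have hJc : ∀ v v' w, g v = 0 → g v' = 0 → f v' = j (f v) → f w = 0 →
      J (Θ.mkQ (c v w)) = Θ.mkQ (c v' w) := by
    intro v v' w hv hv' hvv' hw
    simp only [hJ, Submodule.mkQ_apply, Submodule.mapQ_apply]
    rw [eq_comm, Submodule.Quotient.eq, hΘ, ← map_mem_map_ker_iff]
    simpa [hsf] using hcj v v' w hv hv' hvv' hw
  have hKc : ∀ w w' v, f w = 0 → f w' = 0 → g w' = k (g w) → g v = 0 →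
      K (Θ.mkQ (c v w)) = Θ.mkQ (c v w') := by
    intro w w' v hw hw' hww' hv
    simp only [hK, Submodule.mkQ_apply, Submodule.mapQ_apply]
    rw [eq_comm, Submodule.Quotient.eq, hΘ, ← map_mem_map_ker_iff']
    simpa [hsg] using hck w w' v hw hw' hww' hv
  -- For a fixed nonzero `v`, injectivity and equality of dimensions show that every `q` is the
  -- class of some `c v w`. There both composites equal the class of `c v' w'`, where the primes
  -- denote multiplication by `j` and by `k`.
  have hcomm : ∀ q, J (K q) = K (J q) := by
    obtain ⟨v, hv, hv0⟩ := exists_ker_ne_zero g hg hT hB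
    have hinj : Function.Injective ((Θ.mkQ ∘ₗ c v).domRestrict (LinearMap.ker f)) := by
      rw [← LinearMap.ker_eq_bot, LinearMap.ker_eq_bot']
      rintro ⟨w, hw⟩ h
      by_contra hw0
      refine hc v w hv hw hv0 (fun h => hw0 (Subtype.ext h)) ?_
      simpa using h
    have hsurj := (LinearMap.injective_iff_surjective_of_finrank_eq_finrank
      ((finrank_ker_of_surjective f hf hT hA).trans hQ.symm)).1 hinj
    intro q
    obtain ⟨⟨w, hw⟩, rfl⟩ := hsurj q
    obtain ⟨v', hv', hvv'⟩ := hjP v hv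
    obtain ⟨w', hw', hww'⟩ := hkP w hw
    change J (K (Θ.mkQ (c v w))) = K (J (Θ.mkQ (c v w)))
    rw [hKc w w' v hw hw' hww' hv, hJc v v' w' hv hv' hvv' hw', hJc v v' w hv hv' hvv' hw,
      hKc w w' v' hw hw' hww' hv']
  have key : ∀ ε : ℝ, (∀ q, J q = ε • K q) → ∀ u u', f u' = j (f u) →
      g u' - ε • k (g u) ∈ (LinearMap.ker f).map g := by
    intro ε h u u' huu'
    have h1 : Θ.mkQ u' = ε • Θ.mkQ (sg (k (g u))) := by
      rw [← show K (Θ.mkQ u) = Θ.mkQ (sg (k (g u))) from rfl, ← h,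
        show J (Θ.mkQ u) = Θ.mkQ (sf (j (f u))) from rfl, ← sub_eq_zero, ← map_sub,
        Submodule.mkQ_apply, Submodule.Quotient.mk_eq_zero]
      refine Submodule.mem_sup_left ?_
      simp [hsf, huu']
    rw [← map_smul, ← sub_eq_zero, ← map_sub, Submodule.mkQ_apply, Submodule.Quotient.mk_eq_zero,
      hΘ, ← map_mem_map_ker_iff'] at h1
    simpa [hsg] using h1
  rcases eq_or_eq_neg_of_commute_of_finrank_eq_two J K hJJ hKK hcomm hQ with h | h
  · exact ⟨1, Or.inl rfl, key 1 (by simpa using h)⟩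
  · exact ⟨-1, Or.inr rfl, key (-1) (by simpa using h)⟩

omit [FiniteDimensional ℝ T] in
-- The pairing is `k`-linear in its second variable, and on the quotient `j` is ε times `k`. Hence ε
-- `k` acting on the second variable becomes `j` acting on the value.
theorem pairing_linear_of_sign (f : T →ₗ[ℝ] A) (g : T →ₗ[ℝ] B)
    (hf : Function.Surjective f) (c : T →ₗ[ℝ] T →ₗ[ℝ] T) (j : A →ₗ[ℝ] A) (k : B →ₗ[ℝ] B)
    (hck : ∀ w w' v, f w = 0 → f w' = 0 → g w' = k (g w) → g v = 0 →
      g (c v w') - k (g (c v w)) ∈ (LinearMap.ker f).map g)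
    {ε : ℝ} (hε : ε = 1 ∨ ε = -1)
    (hs : ∀ u u', f u' = j (f u) → g u' - ε • k (g u) ∈ (LinearMap.ker f).map g)
    {v w w' : T} (hv : g v = 0) (hw : f w = 0) (hw' : f w' = 0) (hww' : g w' = ε • k (g w)) :
    f (c v w') - j (f (c v w)) ∈ (LinearMap.ker g).map f := by
  have hεε : ε * ε = 1 := by rcases hε with rfl | rfl <;> norm_num
  obtain ⟨u', hu'⟩ := hf (j (f (c v w)))
  have h1 := hs _ _ hu'
  -- As ε² = 1, the vector ε w' is the one whose image is exactly `k (g w)`.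
  have h2 := hck w (ε • w') v hw (by simp [hw']) (by simp [hww', smul_smul, hεε]) hv
  have h3 : g (c v w' - u') ∈ (LinearMap.ker f).map g := by
    have := Submodule.sub_mem _ (Submodule.smul_mem _ ε h2) h1
    simpa [smul_sub, smul_smul, hεε] using this
  rw [map_mem_map_ker_iff', ← map_mem_map_ker_iff] at h3
  simpa [hu'] using h3

end TransversePair

theorem two_le_infty : (2 : WithTop ℕ∞) ≤ ∞ :=
  WithTop.coe_le_coe.2 (le_top : (2 : ℕ∞) ≤ ⊤)

/-! ### Smooth one-sided inverses, kernel sections and local inverses. -/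

section SmoothInverses

variable {E F G : Type*} [NormedAddCommGroup E] [NormedSpace ℝ E]
  [NormedAddCommGroup F] [NormedSpace ℝ F] [NormedAddCommGroup G] [NormedSpace ℝ G]

/-- With B a fixed right inverse of `A a`, the endomorphism `A z` ∘ B stays invertible near `a`.
Composing B with its inverse gives the family, and inversion of units is smooth. -/
theorem exists_smooth_rightInverse [FiniteDimensional ℝ G] {A : E → F →L[ℝ] G} {a : E}
    (hA : ContinuousAt A a) (hsurj : Function.Surjective (A a)) :
    ∃ S : E → G →L[ℝ] F, ∀ᶠ z in 𝓝 a, (∀ u, A z (S z u) = u) ∧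
      ∀ n, ContDiffAt ℝ n A z → ContDiffAt ℝ n S z := by
  have : CompleteSpace G := FiniteDimensional.complete ℝ G
  obtain ⟨B, hB⟩ := (A a).exists_rightInverse_of_surjective (LinearMap.range_eq_top.2 hsurj)
  refine ⟨fun z => B ∘L Ring.inverse (A z ∘L B), ?_⟩
  have hcont : ContinuousAt (fun z => A z ∘L B) a := hA.clm_comp continuousAt_const
  have hunit : ∀ᶠ z in 𝓝 a, IsUnit (A z ∘L B) := by
    refine hcont.eventually_mem (s := {x | IsUnit x}) (Units.isOpen.mem_nhds ?_)
    rw [Set.mem_ofPred_eq, hB]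
    exact isUnit_one
  filter_upwards [hunit] with z hz
  refine ⟨fun u => ?_, fun n hn => ?_⟩
  · exact DFunLike.congr_fun (Ring.mul_inverse_cancel _ hz) u
  · obtain ⟨w, hw⟩ := hz
    have h1 : ContDiffAt ℝ n Ring.inverse (A z ∘L B) := by
      rw [← hw]
      exact contDiffAt_ringInverse ℝ w
    exact contDiffAt_const.clm_comp
      (ContDiffAt.comp (f := fun z => A z ∘L B) z h1 (hn.clm_comp contDiffAt_const))

theorem exists_smooth_leftInverse [FiniteDimensional ℝ F] [FiniteDimensional ℝ G]
    {A : E → F →L[ℝ] G} {a : E} (hA : ContinuousAt A a) (hinj : Function.Injective (A a)) :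
    ∃ S : E → G →L[ℝ] F, ∀ᶠ z in 𝓝 a, (∀ u, S z (A z u) = u) ∧
      ∀ n, ContDiffAt ℝ n A z → ContDiffAt ℝ n S z := by
  have : CompleteSpace F := FiniteDimensional.complete ℝ F
  obtain ⟨B', hB'⟩ := (A a).toLinearMap.exists_leftInverse_of_injective
    (LinearMap.ker_eq_bot.2 hinj)
  set B := LinearMap.toContinuousLinearMap B' with hBdef
  have hB : B ∘L A a = 1 := by
    ext u
    exact LinearMap.congr_fun hB' u
  refine ⟨fun z => Ring.inverse (B ∘L A z) ∘L B, ?_⟩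
  have hcont : ContinuousAt (fun z => B ∘L A z) a := continuousAt_const.clm_comp hA
  have hunit : ∀ᶠ z in 𝓝 a, IsUnit (B ∘L A z) := by
    refine hcont.eventually_mem (s := {x | IsUnit x}) (Units.isOpen.mem_nhds ?_)
    rw [Set.mem_ofPred_eq, hB]
    exact isUnit_one
  filter_upwards [hunit] with z hz
  refine ⟨fun u => ?_, fun n hn => ?_⟩
  · exact DFunLike.congr_fun (Ring.inverse_mul_cancel _ hz) u
  · obtain ⟨w, hw⟩ := hz
    have h1 : ContDiffAt ℝ n Ring.inverse (B ∘L A z) := by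
      rw [← hw]
      exact contDiffAt_ringInverse ℝ w
    exact (ContDiffAt.comp (f := fun z => B ∘L A z) z h1
      (contDiffAt_const.clm_comp hn)).clm_comp contDiffAt_const

/-- The constant vector `v₀` is corrected by a right inverse applied to `A z v₀`; the correction
vanishes at `a`. -/
theorem exists_smooth_section_ker [FiniteDimensional ℝ G] {A : E → F →L[ℝ] G} {a : E}
    (hA : ∀ᶠ z in 𝓝 a, ContDiffAt ℝ ∞ A z) (hsurj : Function.Surjective (A a)) {v₀ : F}
    (hv₀ : A a v₀ = 0) :
    ∃ v : E → F, v a = v₀ ∧ ∀ᶠ z in 𝓝 a, A z (v z) = 0 ∧ ContDiffAt ℝ ∞ v z := by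
  obtain ⟨S, hS⟩ := exists_smooth_rightInverse hA.self_of_nhds.continuousAt hsurj
  refine ⟨fun z => v₀ - S z (A z v₀), by simp [hv₀], ?_⟩
  filter_upwards [hS, hA] with z hz hAz
  refine ⟨by simp [hz.1], ?_⟩
  exact contDiffAt_const.sub ((hz.2 _ hAz).clm_apply (hAz.clm_apply contDiffAt_const))

/-- The inverse function theorem, restricted to an open set where the derivative is invertible, so
that the inverse is smooth on the whole target and not only at one point. -/
theorem exists_smooth_localInverse [FiniteDimensional ℝ E] [FiniteDimensional ℝ F]
    {f : E → F} {a : E} (hf : ∀ᶠ z in 𝓝 a, ContDiffAt ℝ ∞ f z)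
    (hinj : ∀ u, fderiv ℝ f a u = 0 → u = 0)
    (hdim : Module.finrank ℝ E = Module.finrank ℝ F) :
    ∃ Φ : OpenPartialHomeomorph E F, (Φ : E → F) = f ∧ a ∈ Φ.source ∧
      (∀ z ∈ Φ.source, ContDiffAt ℝ ∞ f z) ∧ ∀ y ∈ Φ.target, ContDiffAt ℝ ∞ Φ.symm y := by
  have : CompleteSpace E := FiniteDimensional.complete ℝ E
  have : CompleteSpace F := FiniteDimensional.complete ℝ F
  have hker : LinearMap.ker (fderiv ℝ f a).toLinearMap = ⊥ :=
    LinearMap.ker_eq_bot'.2 hinj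
  have hbij : Function.Bijective (fderiv ℝ f a).toLinearMap :=
    ⟨LinearMap.ker_eq_bot.1 hker, (LinearMap.injective_iff_surjective_of_finrank_eq_finrank hdim).1
      (LinearMap.ker_eq_bot.1 hker)⟩
  let e : E ≃L[ℝ] F := (LinearEquiv.ofBijective _ hbij).toContinuousLinearEquiv
  have he : (e : E →L[ℝ] F) = fderiv ℝ f a := by ext u; rfl
  have hd : HasFDerivAt f (e : E →L[ℝ] F) a := by
    rw [he]
    exact (hf.self_of_nhds.differentiableAt (by simp)).hasFDerivAt
  set Ψ := hf.self_of_nhds.toOpenPartialHomeomorph f hd (by simp) with hΨ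
  have hcont : ContinuousAt (fderiv ℝ f) a :=
    (hf.self_of_nhds.fderiv_right (m := 0) (by simp)).continuousAt
  have hev : ∀ᶠ z in 𝓝 a, ContDiffAt ℝ ∞ f z ∧
      fderiv ℝ f z ∈ Set.range ((↑) : (E ≃L[ℝ] F) → E →L[ℝ] F) := by
    refine hf.and (hcont.eventually_mem ?_)
    rw [← he]
    exact ContinuousLinearEquiv.nhds e
  obtain ⟨O, hO, hOo, haO⟩ := eventually_nhds_iff.1 hev
  refine ⟨Ψ.restrOpen O hOo, rfl,
    ⟨ContDiffAt.mem_toOpenPartialHomeomorph_source _ _ _, haO⟩, fun z hz => (hO z hz.2).1, ?_⟩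
  intro y hy
  have hy' : (Ψ.restrOpen O hOo).symm y ∈ (Ψ.restrOpen O hOo).source :=
    (Ψ.restrOpen O hOo).map_target hy
  obtain ⟨e', he'⟩ := (hO _ hy'.2).2
  refine (Ψ.restrOpen O hOo).contDiffAt_symm hy (f₀' := e') ?_ (hO _ hy'.2).1
  rw [he']
  exact ((hO _ hy'.2).1.differentiableAt (by simp)).hasFDerivAt

end SmoothInverses

/-! ### Elliptic pairs of submersions and their symmetry. -/

section EllipticPairs

variable {T A B : Type*} [NormedAddCommGroup T] [NormedSpace ℝ T]
  [NormedAddCommGroup A] [NormedSpace ℝ A] [NormedAddCommGroup B] [NormedSpace ℝ B]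

/-- The field of subspaces `dL (ker dR)`. -/
def pairPlane (L : T → A) (R : T → B) (a : T) : Submodule ℝ A :=
  (LinearMap.ker (fderiv ℝ R a).toLinearMap).map (fderiv ℝ L a).toLinearMap

theorem mem_pairPlane {L : T → A} {R : T → B} {a : T} {y : A} :
    y ∈ pairPlane L R a ↔ ∃ v, fderiv ℝ R a v = 0 ∧ fderiv ℝ L a v = y := Iff.rfl

/-- The pair `L, R` of maps is elliptic at `a`: the pairing of `ker dR` and `ker dL`, with values
in the quotient by `ker dL + ker dR`, given by the bracket of vector fields, is nondegenerate. -/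
def EllipticAt (L : T → A) (R : T → B) (a : T) : Prop :=
  ∀ v w, fderiv ℝ R a v = 0 → fderiv ℝ L a w = 0 → v ≠ 0 → w ≠ 0 →
    ∀ p q, fderiv ℝ L a p = fderiv ℝ (fderiv ℝ L) a v w →
      fderiv ℝ R a q = fderiv ℝ (fderiv ℝ R) a v w →
      p - q ∉ LinearMap.ker (fderiv ℝ L a).toLinearMap ⊔ LinearMap.ker (fderiv ℝ R a).toLinearMap

theorem ContDiffAt.fderiv_fderiv_symm {L : T → A} {a : T} (hL : ContDiffAt ℝ ∞ L a) (v w : T) :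
    fderiv ℝ (fderiv ℝ L) a v w = fderiv ℝ (fderiv ℝ L) a w v :=
  hL.isSymmSndFDerivAt (by simpa using two_le_infty) v w

/-- Exchanging the maps exchanges `p` and `q`, since second derivatives are symmetric; the pairing
only changes sign. This is the core of the duality. -/
theorem EllipticAt.symm {L : T → A} {R : T → B} {a : T} (h : EllipticAt L R a)
    (hL : ContDiffAt ℝ ∞ L a) (hR : ContDiffAt ℝ ∞ R a) : EllipticAt R L a := by
  intro v w hv hw hv0 hw0 p q hp hq hpq
  refine h w v hw hv hw0 hv0 q p (by rw [hq, hL.fderiv_fderiv_symm])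
    (by rw [hp, hR.fderiv_fderiv_symm]) ?_
  rw [sup_comm, ← neg_sub]
  exact Submodule.neg_mem _ hpq

/-- The derivative of the section `dL v` of `dL (ker dR)`, for a field `v` of vectors of `ker dR`,
in terms of the second derivatives of `L` and `R`. -/
theorem fderiv_section_sub_mem {L : T → A} {R : T → B} {a : T} (hL : ContDiffAt ℝ ∞ L a)
    (hR : ContDiffAt ℝ ∞ R a) {v : T → T} (hv : DifferentiableAt ℝ v a)
    (hvR : ∀ᶠ z in 𝓝 a, fderiv ℝ R z (v z) = 0) {w p q : T}
    (hp : fderiv ℝ L a p = fderiv ℝ (fderiv ℝ L) a w (v a))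
    (hq : fderiv ℝ R a q = fderiv ℝ (fderiv ℝ R) a w (v a)) :
    fderiv ℝ (fun z => fderiv ℝ L z (v z)) a w - fderiv ℝ L a (p - q) ∈ pairPlane L R a := by
  have hL' : DifferentiableAt ℝ (fderiv ℝ L) a :=
    (hL.fderiv_right (m := 1) (one_add_one_eq_two.trans_le two_le_infty)).differentiableAt (by simp)
  have hR' : DifferentiableAt ℝ (fderiv ℝ R) a :=
    (hR.fderiv_right (m := 1) (one_add_one_eq_two.trans_le two_le_infty)).differentiableAt (by simp)
  have h1 : fderiv ℝ (fun z => fderiv ℝ L z (v z)) a w =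
      fderiv ℝ L a (fderiv ℝ v a w) + fderiv ℝ (fderiv ℝ L) a w (v a) := by
    rw [fderiv_clm_apply hL' hv]; simp
  -- Differentiating dR(v) = 0 along `w` shows that the derivative of `v` is `-q` modulo ker dR.
  have h2 : fderiv ℝ R a (fderiv ℝ v a w) + fderiv ℝ (fderiv ℝ R) a w (v a) = 0 := by
    have h3 : fderiv ℝ (fun z => fderiv ℝ R z (v z)) a w = 0 := by
      rw [Filter.EventuallyEq.fderiv_eq (f := fun _ => (0 : B)) hvR]; simp
    rw [fderiv_clm_apply hR' hv] at h3
    simpa using h3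
  refine mem_pairPlane.2 ⟨fderiv ℝ v a w + q, by rw [map_add, hq, h2], ?_⟩
  rw [h1, map_sub, map_add, hp]
  abel

/-- `L` and `R` form on the open set `O` a transverse pair of submersions, elliptic everywhere. -/
structure EllipticPairOn (L : T → A) (R : T → B) (O : Set T) : Prop where
  isOpen : IsOpen O
  smooth_left : ∀ a ∈ O, ContDiffAt ℝ ∞ L a
  smooth_right : ∀ a ∈ O, ContDiffAt ℝ ∞ R a
  surjective_left : ∀ a ∈ O, Function.Surjective (fderiv ℝ L a)
  surjective_right : ∀ a ∈ O, Function.Surjective (fderiv ℝ R a)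
  transverse : ∀ a ∈ O, ∀ u, fderiv ℝ L a u = 0 → fderiv ℝ R a u = 0 → u = 0
  elliptic : ∀ a ∈ O, EllipticAt L R a

namespace EllipticPairOn

variable {L : T → A} {R : T → B} {O : Set T}

theorem symm (h : EllipticPairOn L R O) : EllipticPairOn R L O :=
  ⟨h.isOpen, h.smooth_right, h.smooth_left, h.surjective_right, h.surjective_left,
    fun a ha u h1 h2 => h.transverse a ha u h2 h1,
    fun a ha => (h.elliptic a ha).symm (h.smooth_left a ha) (h.smooth_right a ha)⟩

theorem mono (h : EllipticPairOn L R O) {O' : Set T} (hO' : IsOpen O') (hsub : O' ⊆ O) :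
    EllipticPairOn L R O' :=
  ⟨hO', fun a ha => h.smooth_left a (hsub ha), fun a ha => h.smooth_right a (hsub ha),
    fun a ha => h.surjective_left a (hsub ha), fun a ha => h.surjective_right a (hsub ha),
    fun a ha => h.transverse a (hsub ha), fun a ha => h.elliptic a (hsub ha)⟩

theorem eventually_mem (h : EllipticPairOn L R O) {a : T} (ha : a ∈ O) : ∀ᶠ z in 𝓝 a, z ∈ O :=
  h.isOpen.mem_nhds ha

theorem eventually_contDiffAt_fderiv_left (h : EllipticPairOn L R O) {a : T} (ha : a ∈ O) :
    ∀ᶠ z in 𝓝 a, ContDiffAt ℝ ∞ (fderiv ℝ L) z := by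
  filter_upwards [h.eventually_mem ha] with z hz
  exact (h.smooth_left z hz).fderiv_right (by simp)

theorem exists_section (h : EllipticPairOn L R O) [FiniteDimensional ℝ B] {a : T} (ha : a ∈ O)
    {v₀ : T} (hv₀ : fderiv ℝ R a v₀ = 0) :
    ∃ v : T → T, v a = v₀ ∧ ∀ᶠ z in 𝓝 a, fderiv ℝ R z (v z) = 0 ∧ ContDiffAt ℝ ∞ v z :=
  exists_smooth_section_ker (h.symm.eventually_contDiffAt_fderiv_left ha)
    (h.surjective_right a ha) hv₀

variable [FiniteDimensional ℝ T] [FiniteDimensional ℝ A] [FiniteDimensional ℝ B]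

/-- A smooth family of left inverses of `(dL, dR)`. -/
theorem exists_leftInverse (h : EllipticPairOn L R O) {a : T} (ha : a ∈ O) :
    ∃ S : T → A × B →L[ℝ] T, ∀ᶠ z in 𝓝 a,
      (∀ u, S z (fderiv ℝ L z u, fderiv ℝ R z u) = u) ∧ ContDiffAt ℝ ∞ S z := by
  have hsm : ∀ᶠ z in 𝓝 a, ContDiffAt ℝ ∞ (fun z => (fderiv ℝ L z).prod (fderiv ℝ R z)) z := by
    filter_upwards [h.eventually_contDiffAt_fderiv_left ha,
      h.symm.eventually_contDiffAt_fderiv_left ha] with z h1 h2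
    exact (ContinuousLinearMap.prodₗᵢ ℝ).contDiff.contDiffAt.comp z (h1.prodMk h2)
  have hinj : Function.Injective ((fderiv ℝ L a).prod (fderiv ℝ R a)) := by
    rw [injective_iff_map_eq_zero]
    intro u hu
    simp only [ContinuousLinearMap.prod_apply, Prod.mk_eq_zero] at hu
    exact h.transverse a ha u hu.1 hu.2
  obtain ⟨S, hS⟩ := exists_smooth_leftInverse hsm.self_of_nhds.continuousAt hinj
  refine ⟨S, ?_⟩
  filter_upwards [hS, hsm] with z h1 h2
  exact ⟨h1.1, h1.2 _ h2⟩

/-- A section of `dL (ker dR)` lifts to `ker dR`. -/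
theorem exists_lift (h : EllipticPairOn L R O) {a : T} (ha : a ∈ O) {s : T → A}
    (hs : ∀ᶠ z in 𝓝 a, s z ∈ pairPlane L R z) :
    ∃ v : T → T, (∀ᶠ z in 𝓝 a, fderiv ℝ R z (v z) = 0 ∧ fderiv ℝ L z (v z) = s z) ∧
      (DifferentiableAt ℝ s a → DifferentiableAt ℝ v a) := by
  obtain ⟨S, hS⟩ := h.exists_leftInverse ha
  -- By transversality the only possible lift is the vector with image `s z` under dL and 0 under
  -- dR; the left inverse recovers it.
  refine ⟨fun z => S z (s z, 0), ?_, fun hd => ?_⟩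
  · filter_upwards [hS, hs] with z h1 h2
    obtain ⟨v, hv, hv'⟩ := mem_pairPlane.1 h2
    have h3 : S z (s z, 0) = v := by rw [← hv', ← hv, h1.1]
    exact ⟨by rw [h3, hv], by rw [h3, hv']⟩
  · exact (hS.self_of_nhds.2.differentiableAt (by simp)).clm_apply
      (hd.prodMk (differentiableAt_const _))

/-- The derivative of a nonvanishing section of `dL (ker dR)` along a vector of `ker dL` is not
tangent. -/
theorem fderiv_section_notMem (h : EllipticPairOn L R O) {a : T} (ha : a ∈ O) {s : T → A}
    (hs : ∀ᶠ z in 𝓝 a, s z ∈ pairPlane L R z) (hd : DifferentiableAt ℝ s a) (hs0 : s a ≠ 0)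
    {w : T} (hw : fderiv ℝ L a w = 0) (hw0 : w ≠ 0) : fderiv ℝ s a w ∉ pairPlane L R a := by
  intro hmem
  obtain ⟨v, hv, hvd⟩ := h.exists_lift ha hs
  have hva := hv.self_of_nhds
  have hva0 : v a ≠ 0 := by
    intro h0
    apply hs0
    rw [← hva.2, h0, map_zero]
  obtain ⟨p, hp⟩ := h.surjective_left a ha (fderiv ℝ (fderiv ℝ L) a w (v a))
  obtain ⟨q, hq⟩ := h.surjective_right a ha (fderiv ℝ (fderiv ℝ R) a w (v a))
  have h1 := fderiv_section_sub_mem (h.smooth_left a ha) (h.smooth_right a ha) (hvd hd)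
    (hv.mono fun z hz => hz.1) hp hq
  rw [Filter.EventuallyEq.fderiv_eq (hv.mono fun z hz => hz.2)] at h1
  have h2 : fderiv ℝ L a (p - q) ∈ pairPlane L R a := by
    have := Submodule.sub_mem _ hmem h1
    simpa using this
  refine h.elliptic a ha (v a) w hva.1 hw hva0 hw0 p q
    (by rw [hp, (h.smooth_left a ha).fderiv_fderiv_symm])
    (by rw [hq, (h.smooth_right a ha).fderiv_fderiv_symm]) ?_
  rw [← map_mem_map_ker_iff]
  exact h2

end EllipticPairOn

end EllipticPairs

/-! ### Complex-linear functionals and limits in subspaces. -/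

section ComplexFunctionals

variable {A : Type*} [NormedAddCommGroup A] [NormedSpace ℝ A] [FiniteDimensional ℝ A]

/-- The complex linear functional with given real part. -/
def complexFunctional (j : A →L[ℝ] A) (r : A →ₗ[ℝ] ℝ) : A →L[ℝ] ℂ :=
  LinearMap.toContinuousLinearMap
    (Complex.ofRealCLM.toLinearMap ∘ₗ r -
      Complex.I • (Complex.ofRealCLM.toLinearMap ∘ₗ r ∘ₗ j.toLinearMap))

theorem complexFunctional_apply (j : A →L[ℝ] A) (r : A →ₗ[ℝ] ℝ) (y : A) :
    complexFunctional j r y = r y - Complex.I * r (j y) := by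
  simp [complexFunctional]

theorem complexFunctional_map (j : A →L[ℝ] A) (hj : ∀ y, j (j y) = -y) (r : A →ₗ[ℝ] ℝ) (y : A) :
    complexFunctional j r (j y) = Complex.I * complexFunctional j r y := by
  simp only [complexFunctional_apply, hj, map_neg, Complex.ofReal_neg, mul_sub, ← mul_assoc,
    Complex.I_mul_I]
  ring

theorem exists_complexFunctional_ne_zero (j : A →L[ℝ] A) (hj : ∀ y, j (j y) = -y) {s : A}
    (hs : s ≠ 0) :
    ∃ α : A →L[ℝ] ℂ, (∀ y, α (j y) = Complex.I * α y) ∧ α s ≠ 0 := by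
  obtain ⟨r, hr⟩ : ∃ r : Module.Dual ℝ A, r s ≠ 0 := by
    by_contra! h
    exact hs ((Module.forall_dual_apply_eq_zero_iff ℝ s).1 h)
  refine ⟨complexFunctional j r, complexFunctional_map j hj r, fun h => hr ?_⟩
  have := congrArg Complex.re h
  simpa [complexFunctional_apply] using this

/-- Complexify a nonzero real functional that vanishes on `P`. As `P` is `j`-stable the result still
vanishes there; it is onto ℂ, so its kernel has real dimension 4 - 2 and must be `P`. -/
theorem exists_complexFunctional_ker_eq (j : A →L[ℝ] A) (hj : ∀ y, j (j y) = -y)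
    (hA : Module.finrank ℝ A = 4) (P : Submodule ℝ A) (hP : ∀ y ∈ P, j y ∈ P)
    (hfin : Module.finrank ℝ P = 2) :
    ∃ β : A →L[ℝ] ℂ, (∀ y, β (j y) = Complex.I * β y) ∧ ∀ y, β y = 0 ↔ y ∈ P := by
  obtain ⟨e, he⟩ : ∃ e, e ∉ P := by
    by_contra! h
    rw [(Submodule.eq_top_iff' (p := P)).2 h, finrank_top] at hfin
    omega
  obtain ⟨r, hre, hrP⟩ := Submodule.exists_le_ker_of_notMem he
  set β := complexFunctional j r with hβ
  have hβj := complexFunctional_map j hj r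
  have hPβ : P ≤ LinearMap.ker β.toLinearMap := by
    intro y hy
    have h1 : r y = 0 := hrP hy
    have h2 : r (j y) = 0 := hrP (hP y hy)
    simp [hβ, complexFunctional_apply, h1, h2]
  have hβe : β e ≠ 0 := by
    intro h
    have := congrArg Complex.re h
    exact hre (by simpa [hβ, complexFunctional_apply] using this)
  have hsurj : Function.Surjective β.toLinearMap := by
    intro z
    refine ⟨(z / β e).re • e + (z / β e).im • j e, ?_⟩
    have h1 : β ((z / β e).re • e + (z / β e).im • j e) =
        (((z / β e).re : ℂ) + (z / β e).im * Complex.I) * β e := by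
      rw [map_add, map_smul, map_smul, hβj]
      simp only [Complex.real_smul]
      ring
    rw [Complex.re_add_im, div_mul_cancel₀ _ hβe] at h1
    exact h1
  have hker := β.toLinearMap.finrank_range_add_finrank_ker
  rw [LinearMap.range_eq_top.2 hsurj, finrank_top, Complex.finrank_real_complex, hA] at hker
  have hPeq := Submodule.eq_of_le_of_finrank_eq hPβ (by omega)
  exact ⟨β, hβj, fun y => by rw [hPeq]; rfl⟩

end ComplexFunctionals

section

variable {V : Type*} [NormedAddCommGroup V] [NormedSpace ℝ V] [FiniteDimensional ℝ V]

theorem HasDerivAt.mem_of_eventually_mem_submodule {f : ℝ → V} {f' : V} {t : ℝ}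
    (hf : HasDerivAt f f' t) {S : Submodule ℝ V} (hS : ∀ᶠ x in 𝓝 t, f x ∈ S) : f' ∈ S := by
  refine S.closed_of_finiteDimensional.mem_of_tendsto (hasDerivAt_iff_tendsto_slope.1 hf) ?_
  filter_upwards [nhdsWithin_le_nhds hS] with x hx
  exact S.smul_mem _ (S.sub_mem hx hS.self_of_nhds)

end

/-! ### Complex linearity of the pairing and the sign. -/

section AlmostComplexPairs

variable {T A B : Type*} [NormedAddCommGroup T] [NormedSpace ℝ T]
  [NormedAddCommGroup A] [NormedSpace ℝ A] [NormedAddCommGroup B] [NormedSpace ℝ B]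

/-- The planes `dL (ker dR)` are complex lines for the almost complex structure `j`. -/
structure IsComplexPair (L : T → A) (R : T → B) (O : Set T) (j : A → A →L[ℝ] A) : Prop where
  differentiableAt : ∀ a ∈ O, DifferentiableAt ℝ j (L a)
  sq_eq_neg : ∀ a ∈ O, ∀ y, j (L a) (j (L a) y) = -y
  map_mem : ∀ a ∈ O, ∀ y ∈ pairPlane L R a, j (L a) y ∈ pairPlane L R a

/-- The complex structures on the quotient by `ker dL + ker dR` agree up to the sign `ε`. -/
def IsSignAt (L : T → A) (R : T → B) (j : A → A →L[ℝ] A) (k : B → B →L[ℝ] B) (ε : ℝ) (a : T) :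
    Prop :=
  ∀ u u', fderiv ℝ L a u' = j (L a) (fderiv ℝ L a u) →
    fderiv ℝ R a u' - ε • k (R a) (fderiv ℝ R a u) ∈ pairPlane R L a

/-- Along ker dL the base point does not move to first order, so `j` behaves as a constant. -/
theorem fderiv_complex_section {L : T → A} {j : A → A →L[ℝ] A} {a : T}
    (hL : DifferentiableAt ℝ L a) (hj : DifferentiableAt ℝ j (L a)) {s : T → A}
    (hs : DifferentiableAt ℝ s a) {w : T} (hw : fderiv ℝ L a w = 0) :
    fderiv ℝ (fun z => j (L z) (s z)) a w = j (L a) (fderiv ℝ s a w) := by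
  have hjL : DifferentiableAt ℝ (fun z => j (L z)) a := hj.comp a hL
  have h1 : fderiv ℝ (fun z => j (L z)) a w = 0 := by
    rw [show (fun z => j (L z)) = j ∘ L from rfl, fderiv_comp a hj hL]
    simp [hw]
  rw [fderiv_clm_apply hjL hs]
  simp [h1]

namespace EllipticPairOn

variable {L : T → A} {R : T → B} {O : Set T} {j : A → A →L[ℝ] A} {k : B → B →L[ℝ] B}
variable [FiniteDimensional ℝ T] [FiniteDimensional ℝ A] [FiniteDimensional ℝ B]

/-- If s is a section of the planes through dL(v), then j s is one too, and its lift takes the value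
`v'` at `a`. Along `w` the derivative of j s is j times that of s, and `fderiv_section_sub_mem`
converts both derivatives into pairings. -/
theorem pairing_complexLinear (h : EllipticPairOn L R O) (hj : IsComplexPair L R O j) {a : T}
    (ha : a ∈ O) {v v' w p q p' q' : T} (hv : fderiv ℝ R a v = 0) (hv' : fderiv ℝ R a v' = 0)
    (hvv' : fderiv ℝ L a v' = j (L a) (fderiv ℝ L a v)) (hw : fderiv ℝ L a w = 0)
    (hp : fderiv ℝ L a p = fderiv ℝ (fderiv ℝ L) a v w)
    (hq : fderiv ℝ R a q = fderiv ℝ (fderiv ℝ R) a v w)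
    (hp' : fderiv ℝ L a p' = fderiv ℝ (fderiv ℝ L) a v' w)
    (hq' : fderiv ℝ R a q' = fderiv ℝ (fderiv ℝ R) a v' w) :
    fderiv ℝ L a (p' - q') - j (L a) (fderiv ℝ L a (p - q)) ∈ pairPlane L R a := by
  have hL := h.smooth_left a ha
  have hR := h.smooth_right a ha
  obtain ⟨x, hxa, hx⟩ := h.exists_section ha hv
  have hxd : DifferentiableAt ℝ x a := hx.self_of_nhds.2.differentiableAt (by simp)
  set s : T → A := fun z => fderiv ℝ L z (x z) with hs
  have hsd : DifferentiableAt ℝ s a :=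
    ((h.eventually_contDiffAt_fderiv_left ha).self_of_nhds.differentiableAt (by simp)).clm_apply hxd
  have hjs : ∀ᶠ z in 𝓝 a, j (L z) (s z) ∈ pairPlane L R z := by
    filter_upwards [hx, h.eventually_mem ha] with z hz hzO
    exact hj.map_mem z hzO _ (mem_pairPlane.2 ⟨x z, hz.1, rfl⟩)
  have hLd : DifferentiableAt ℝ L a := hL.differentiableAt (by simp)
  have hjd : DifferentiableAt ℝ (fun z => j (L z) (s z)) a :=
    ((hj.differentiableAt a ha).comp a hLd).clm_apply hsd
  obtain ⟨y, hy, hyd⟩ := h.exists_lift ha hjs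
  have hya : y a = v' := by
    rw [← sub_eq_zero]
    refine h.transverse a ha _ ?_ ?_
    · rw [map_sub, hy.self_of_nhds.2, hvv', hs]
      simp [hxa]
    · rw [map_sub, hy.self_of_nhds.1, hv', sub_zero]
  have h1 := fderiv_section_sub_mem hL hR hxd (hx.mono fun z hz => hz.1) (w := w) (p := p) (q := q)
    (by rw [hp, hxa, hL.fderiv_fderiv_symm]) (by rw [hq, hxa, hR.fderiv_fderiv_symm])
  have h2 := fderiv_section_sub_mem hL hR (hyd hjd) (hy.mono fun z hz => hz.1) (w := w) (p := p')
    (q := q') (by rw [hp', hya, hL.fderiv_fderiv_symm]) (by rw [hq', hya, hR.fderiv_fderiv_symm])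
  rw [Filter.EventuallyEq.fderiv_eq (hy.mono fun z hz => hz.2),
    fderiv_complex_section hLd (hj.differentiableAt a ha) hsd hw] at h2
  have h3 := Submodule.sub_mem _ (hj.map_mem a ha _ h1) h2
  convert! h3 using 1
  rw [map_sub (j (L a))]
  abel

omit [FiniteDimensional ℝ T] in
-- Linear right inverses of dL and dR select `p` and `q` bilinearly, giving a bilinear
-- representative of the bracket pairing.
theorem exists_pairing (h : EllipticPairOn L R O) {a : T} (ha : a ∈ O) :
    ∃ c : T →ₗ[ℝ] T →ₗ[ℝ] T, ∀ v w, ∃ p q, c v w = p - q ∧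
      fderiv ℝ L a p = fderiv ℝ (fderiv ℝ L) a v w ∧
      fderiv ℝ R a q = fderiv ℝ (fderiv ℝ R) a v w := by
  obtain ⟨S, hS⟩ := (fderiv ℝ L a).exists_rightInverse_of_surjective
    (LinearMap.range_eq_top.2 (h.surjective_left a ha))
  obtain ⟨S', hS'⟩ := (fderiv ℝ R a).exists_rightInverse_of_surjective
    (LinearMap.range_eq_top.2 (h.surjective_right a ha))
  refine ⟨LinearMap.mk₂ ℝ (fun v w => S (fderiv ℝ (fderiv ℝ L) a v w) -
    S' (fderiv ℝ (fderiv ℝ R) a v w)) ?_ ?_ ?_ ?_, fun v w => ⟨_, _, rfl, ?_, ?_⟩⟩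
  · intros; simp; abel
  · intros; simp [smul_sub]
  · intros; simp; abel
  · intros; simp [smul_sub]
  · exact DFunLike.congr_fun hS _
  · exact DFunLike.congr_fun hS' _

omit [FiniteDimensional ℝ A] [FiniteDimensional ℝ B] in
theorem finrank_pairPlane (h : EllipticPairOn L R O) (hT : Module.finrank ℝ T = 6)
    (hB : Module.finrank ℝ B = 4) {a : T} (ha : a ∈ O) :
    Module.finrank ℝ (pairPlane L R a) = 2 :=
  finrank_map_ker _ _ (h.surjective_right a ha) hT hB (h.transverse a ha)

theorem pairing_complexLinear_right (h : EllipticPairOn L R O) (hk : IsComplexPair R L O k) {a : T}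
    (ha : a ∈ O) {c : T →ₗ[ℝ] T →ₗ[ℝ] T} (hc : ∀ v w, ∃ p q, c v w = p - q ∧
      fderiv ℝ L a p = fderiv ℝ (fderiv ℝ L) a v w ∧
      fderiv ℝ R a q = fderiv ℝ (fderiv ℝ R) a v w) {w w' v : T}
    (hw : fderiv ℝ L a w = 0) (hw' : fderiv ℝ L a w' = 0)
    (hww' : fderiv ℝ R a w' = k (R a) (fderiv ℝ R a w)) (hv : fderiv ℝ R a v = 0) :
    fderiv ℝ R a (c v w') - k (R a) (fderiv ℝ R a (c v w)) ∈ pairPlane R L a := by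
  have hL := h.smooth_left a ha
  have hR := h.smooth_right a ha
  obtain ⟨p, q, hpq, hp, hq⟩ := hc v w
  obtain ⟨p', q', hpq', hp', hq'⟩ := hc v w'
  have := h.symm.pairing_complexLinear hk ha hw hw' hww' hv
    (hq.trans (hR.fderiv_fderiv_symm _ _)) (hp.trans (hL.fderiv_fderiv_symm _ _))
    (hq'.trans (hR.fderiv_fderiv_symm _ _)) (hp'.trans (hL.fderiv_fderiv_symm _ _))
  rw [hpq, hpq', ← neg_sub q p, ← neg_sub q' p', map_neg, map_neg, map_neg]
  convert! Submodule.neg_mem _ this using 1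
  abel

theorem exists_isSignAt (h : EllipticPairOn L R O) (hT : Module.finrank ℝ T = 6)
    (hA : Module.finrank ℝ A = 4) (hB : Module.finrank ℝ B = 4)
    (hj : IsComplexPair L R O j) (hk : IsComplexPair R L O k) {a : T} (ha : a ∈ O) :
    ∃ ε : ℝ, (ε = 1 ∨ ε = -1) ∧ IsSignAt L R j k ε a := by
  obtain ⟨c, hc⟩ := h.exists_pairing ha
  refine exists_sign_of_complexLinear_pairing (fderiv ℝ L a).toLinearMap (fderiv ℝ R a).toLinearMap
    (h.surjective_left a ha) (h.surjective_right a ha) hT hA hB (h.transverse a ha) c ?_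
    (j (L a)).toLinearMap (k (R a)).toLinearMap (hj.sq_eq_neg a ha) (hk.sq_eq_neg a ha) ?_ ?_ ?_ ?_
  · intro v w hv hw hv0 hw0
    obtain ⟨p, q, hpq, hp, hq⟩ := hc v w
    rw [hpq]
    exact h.elliptic a ha v w hv hw hv0 hw0 p q hp hq
  · exact fun v hv => hj.map_mem a ha _ (mem_pairPlane.2 ⟨v, hv, rfl⟩)
  · exact fun w hw => hk.map_mem a ha _ (mem_pairPlane.2 ⟨w, hw, rfl⟩)
  · intro v v' w hv hv' hvv' hw
    obtain ⟨p, q, hpq, hp, hq⟩ := hc v w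
    obtain ⟨p', q', hpq', hp', hq'⟩ := hc v' w
    rw [hpq, hpq']
    exact h.pairing_complexLinear hj ha hv hv' hvv' hw hp hq hp' hq'
  · intro w w' v hw hw' hww' hv
    exact h.pairing_complexLinear_right hk ha hc hw hw' hww' hv

/-- Along a fibre of L the planes vary complex linearly when the fibre directions carry ε times `k`.
This is `pairing_linear_of_sign` expressed for derivatives of sections. -/
theorem fderiv_section_complexLinear (h : EllipticPairOn L R O)
    (hk : IsComplexPair R L O k) {a : T} (ha : a ∈ O) {ε : ℝ}
    (hε : ε = 1 ∨ ε = -1) (hs : IsSignAt L R j k ε a)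
    (hjP : ∀ y ∈ pairPlane L R a, j (L a) y ∈ pairPlane L R a)
    {v : T → T} (hv : DifferentiableAt ℝ v a)
    (hvR : ∀ᶠ z in 𝓝 a, fderiv ℝ R z (v z) = 0) {w w' : T} (hw : fderiv ℝ L a w = 0)
    (hw' : fderiv ℝ L a w' = 0) (hww' : fderiv ℝ R a w' = ε • k (R a) (fderiv ℝ R a w)) :
    fderiv ℝ (fun z => fderiv ℝ L z (v z)) a w' -
      j (L a) (fderiv ℝ (fun z => fderiv ℝ L z (v z)) a w) ∈ pairPlane L R a := by
  have hL := h.smooth_left a ha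
  have hR := h.smooth_right a ha
  obtain ⟨c, hc⟩ := h.exists_pairing ha
  have key := pairing_linear_of_sign (fderiv ℝ L a).toLinearMap (fderiv ℝ R a).toLinearMap
    (h.surjective_left a ha) c (j (L a)).toLinearMap (k (R a)).toLinearMap
    (fun w w' v hw hw' hww' hv => h.pairing_complexLinear_right hk ha hc hw hw' hww' hv)
    hε hs (v := v a) hvR.self_of_nhds hw hw' hww'
  obtain ⟨p, q, hpq, hp, hq⟩ := hc (v a) w
  obtain ⟨p', q', hpq', hp', hq'⟩ := hc (v a) w'
  have h1 := fderiv_section_sub_mem hL hR hv hvR (hp.trans (hL.fderiv_fderiv_symm _ _))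
    (hq.trans (hR.fderiv_fderiv_symm _ _))
  have h2 := fderiv_section_sub_mem hL hR hv hvR (hp'.trans (hL.fderiv_fderiv_symm _ _))
    (hq'.trans (hR.fderiv_fderiv_symm _ _))
  rw [hpq, hpq'] at key
  have h3 := Submodule.sub_mem _ (Submodule.add_mem _ h2 key) (hjP _ h1)
  convert! h3 using 1
  rw [map_sub (j (L a))]
  simp only [ContinuousLinearMap.coe_coe]
  abel

/-- The left inverse yields the only candidate preimage of `b z`, depending continuously on `z`. Its
failure to solve the two equations is an open condition. -/
theorem eventually_notMem_pairPlane (h : EllipticPairOn L R O) {a : T} (ha : a ∈ O) {b : T → A}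
    (hb : ContinuousAt b a) (hba : b a ∉ pairPlane L R a) :
    ∀ᶠ z in 𝓝 a, b z ∉ pairPlane L R z := by
  obtain ⟨S, hS⟩ := h.exists_leftInverse ha
  have hL := (h.eventually_contDiffAt_fderiv_left ha).self_of_nhds.continuousAt
  have hR := (h.symm.eventually_contDiffAt_fderiv_left ha).self_of_nhds.continuousAt
  set u : T → T := fun z => S z (b z, 0) with hu
  have hcu : ContinuousAt u a :=
    hS.self_of_nhds.2.continuousAt.clm_apply (hb.prodMk continuousAt_const)
  have hcont : ContinuousAt (fun z => (fderiv ℝ L z (u z) - b z, fderiv ℝ R z (u z))) a :=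
    ((hL.clm_apply hcu).sub hb).prodMk (hR.clm_apply hcu)
  have hne : (fderiv ℝ L a (u a) - b a, fderiv ℝ R a (u a)) ≠ 0 := by
    intro h0
    rw [Prod.mk_eq_zero, sub_eq_zero] at h0
    exact hba (mem_pairPlane.2 ⟨u a, h0.2, h0.1⟩)
  filter_upwards [hS, hcont.eventually_ne hne] with z h1 h2 h3
  obtain ⟨v, hv, hv'⟩ := mem_pairPlane.1 h3
  have huv : u z = v := by rw [hu]; simp only; rw [← hv', ← hv, h1.1]
  exact h2 (by rw [huv, hv, hv']; simp)

/-- A sign exists at every point, so it is enough to exclude -ε nearby. A single test vector outside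
ker dL + ker dR does this, by an open condition. -/
theorem eventually_isSignAt (h : EllipticPairOn L R O) (hT : Module.finrank ℝ T = 6)
    (hA : Module.finrank ℝ A = 4) (hB : Module.finrank ℝ B = 4)
    (hj : IsComplexPair L R O j) (hk : IsComplexPair R L O k) {a : T} (ha : a ∈ O) {ε : ℝ}
    (hε : ε = 1 ∨ ε = -1) (hs : IsSignAt L R j k ε a) : ∀ᶠ z in 𝓝 a, IsSignAt L R j k ε z := by
  have hεε : ε * ε = 1 := by rcases hε with rfl | rfl <;> norm_num
  obtain ⟨u, hu⟩ : ∃ u, u ∉ LinearMap.ker (fderiv ℝ L a).toLinearMap ⊔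
      LinearMap.ker (fderiv ℝ R a).toLinearMap := by
    by_contra! hall
    have h1 := finrank_quotient_ker_sup_ker (fderiv ℝ L a).toLinearMap (fderiv ℝ R a).toLinearMap
      (h.surjective_left a ha) (h.surjective_right a ha) hT hA hB (h.transverse a ha)
    have h2 := Submodule.finrank_quotient_add_finrank (LinearMap.ker (fderiv ℝ L a).toLinearMap ⊔
      LinearMap.ker (fderiv ℝ R a).toLinearMap)
    rw [(Submodule.eq_top_iff').2 hall, finrank_top] at h2
    rw [(Submodule.eq_top_iff').2 hall] at h1
    omega
  have hL := (h.eventually_contDiffAt_fderiv_left ha).self_of_nhds.continuousAt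
  have hR := (h.symm.eventually_contDiffAt_fderiv_left ha).self_of_nhds.continuousAt
  obtain ⟨S, hS⟩ := exists_smooth_rightInverse hL (h.surjective_left a ha)
  have hSc : ContinuousAt S a := (hS.self_of_nhds.2 0
    ((h.eventually_contDiffAt_fderiv_left ha).self_of_nhds.of_le (by simp))).continuousAt
  have hjc : ContinuousAt (fun z => j (L z)) a :=
    (hj.differentiableAt a ha).continuousAt.comp (h.smooth_left a ha).continuousAt
  have hkc : ContinuousAt (fun z => k (R z)) a :=
    (hk.differentiableAt a ha).continuousAt.comp (h.smooth_right a ha).continuousAt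
  set u' : T → T := fun z => S z (j (L z) (fderiv ℝ L z u)) with hu'
  have hu'c : ContinuousAt u' a :=
    hSc.clm_apply (hjc.clm_apply (hL.clm_apply continuousAt_const))
  have hbc : ContinuousAt (fun z => fderiv ℝ R z (u' z) + ε • k (R z) (fderiv ℝ R z u)) a :=
    (hR.clm_apply hu'c).add ((hkc.clm_apply (hR.clm_apply continuousAt_const)).const_smul ε)
  -- If both signs held on `u`, the difference would put `k` of dR(u), hence dR(u) itself, into the
  -- plane, against the choice of `u`.
  have hba : fderiv ℝ R a (u' a) + ε • k (R a) (fderiv ℝ R a u) ∉ pairPlane R L a := by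
    intro hmem
    have h1 := Submodule.sub_mem _ hmem (hs u (u' a) (hS.self_of_nhds.1 _))
    have h2 := Submodule.smul_mem _ (ε / 2) h1
    have h3 : k (R a) (fderiv ℝ R a u) ∈ pairPlane R L a := by
      convert! h2 using 1
      rw [add_sub_sub_cancel, smul_add, smul_smul, ← add_smul]
      rw [show ε / 2 * ε + ε / 2 * ε = ε * ε by ring, hεε, one_smul]
    have h4 := hk.map_mem a ha _ h3
    rw [hk.sq_eq_neg a ha, Submodule.neg_mem_iff] at h4
    exact hu ((map_mem_map_ker_iff' _ _ _).1 h4)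
  filter_upwards [h.symm.eventually_notMem_pairPlane ha hbc hba, hS, h.eventually_mem ha]
    with z hz hSz hzO
  obtain ⟨ε', hε', hs'⟩ := h.exists_isSignAt hT hA hB hj hk hzO
  have hcases : ε' = ε ∨ ε' = -ε := by
    rcases hε with rfl | rfl <;> rcases hε' with rfl | rfl <;> simp
  rcases hcases with rfl | rfl
  · exact hs'
  · have := hs' u (u' z) (hSz.1 _)
    rw [neg_smul, sub_neg_eq_add] at this
    exact absurd this hz

/-- Otherwise the planes would be constant along the fibre of L near `a`, because complex lines that
meet nontrivially coincide. A section would then have tangent derivative along the fibre, which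
ellipticity forbids. -/
theorem frequently_disjoint_pairPlane (h : EllipticPairOn L R O)
    (hT : Module.finrank ℝ T = 6) (hA : Module.finrank ℝ A = 4) (hB : Module.finrank ℝ B = 4)
    (hj : IsComplexPair L R O j) {a : T} (ha : a ∈ O) :
    ∃ᶠ z in 𝓝 a, L z = L a ∧ ∀ y, y ∈ pairPlane L R z → y ∈ pairPlane L R a → y = 0 := by
  intro hnot
  have hev : ∀ᶠ z in 𝓝 a, L z = L a → pairPlane L R z = pairPlane L R a := by
    filter_upwards [hnot, h.eventually_mem ha] with z hz hzO hLz
    push Not at hz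
    obtain ⟨y, hy, hy', hy0⟩ := hz hLz
    refine complexLine_eq_of_mem (j (L a)).toLinearMap _ _ (hj.sq_eq_neg a ha)
      ?_ (h.finrank_pairPlane hT hB hzO) (hj.map_mem a ha) (h.finrank_pairPlane hT hB ha) hy hy' hy0
    rw [← hLz]
    exact hj.map_mem z hzO
  obtain ⟨v, hv, hv0⟩ := exists_ker_ne_zero (fderiv ℝ R a).toLinearMap
    (h.surjective_right a ha) hT hB
  obtain ⟨w, hw, hw0⟩ := exists_ker_ne_zero (fderiv ℝ L a).toLinearMap
    (h.surjective_left a ha) hT hA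
  obtain ⟨x, hxa, hx⟩ := h.exists_section ha hv
  set s : T → A := fun z => fderiv ℝ L z (x z) with hs
  have hsP : ∀ᶠ z in 𝓝 a, s z ∈ pairPlane L R z := hx.mono fun z hz =>
    mem_pairPlane.2 ⟨_, hz.1, rfl⟩
  have hsd : DifferentiableAt ℝ s a :=
    ((h.eventually_contDiffAt_fderiv_left ha).self_of_nhds.differentiableAt (by simp)).clm_apply
      (hx.self_of_nhds.2.differentiableAt (by simp))
  have hs0 : s a ≠ 0 := fun h0 => hv0 (h.transverse a ha v (by simpa [hs, hxa] using h0) hv)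
  refine h.fderiv_section_notMem ha hsP hsd hs0 hw hw0 ?_
  have hstrict : HasStrictFDerivAt L (fderiv ℝ L a) a :=
    (h.smooth_left a ha).hasStrictFDerivAt (by simp)
  have : CompleteSpace T := FiniteDimensional.complete ℝ T
  have hrange := LinearMap.range_eq_top.2 (h.surjective_left a ha)
  set w' : LinearMap.ker (fderiv ℝ L a).toLinearMap := ⟨w, hw⟩ with hw'
  have hlin : HasDerivAt (fun t : ℝ => t • w') w' 0 := by
    simpa using (hasDerivAt_id (0 : ℝ)).smul_const w'
  -- The implicit function theorem supplies a curve inside the fibre of L with velocity `w`. The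
  -- section along it stays in one fixed subspace, and therefore so does its derivative.
  set γ : ℝ → T := fun t => hstrict.implicitFunction L (fderiv ℝ L a) hrange (L a) (t • w') with hγ
  have hγ0 : γ 0 = a := by simp [hγ]
  have hγd : HasDerivAt γ w 0 := by
    have h1 := (hstrict.to_implicitFunction hrange).hasFDerivAt
    rw [← zero_smul ℝ w'] at h1
    exact h1.comp_hasDerivAt 0 hlin
  have hγL : ∀ᶠ t in 𝓝 (0 : ℝ), L (γ t) = L a := by
    have hc : Filter.Tendsto (fun t : ℝ => (L a, t • w')) (𝓝 0)
        (𝓝 (L a, (0 : LinearMap.ker (fderiv ℝ L a).toLinearMap))) := by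
      have := (continuousAt_const (y := L a)).prodMk hlin.continuousAt
      simpa [ContinuousAt] using this
    exact hc.eventually (hstrict.map_implicitFunction_eq hrange)
  have hγt : Filter.Tendsto γ (𝓝 0) (𝓝 a) := by
    simpa [ContinuousAt, hγ0] using hγd.continuousAt
  have hsγ : HasDerivAt (fun t => s (γ t)) (fderiv ℝ s a w) 0 := by
    have h1 : HasFDerivAt s (fderiv ℝ s a) (γ 0) := by rw [hγ0]; exact hsd.hasFDerivAt
    exact h1.comp_hasDerivAt 0 hγd
  refine hsγ.mem_of_eventually_mem_submodule ?_
  filter_upwards [hγL, hγt.eventually hev, hγt.eventually hsP] with t h1 h2 h3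
  rw [← h2 h1]
  exact h3

end EllipticPairOn

end AlmostComplexPairs

/-! ### Holomorphic functions from pencils of curves. -/

section HolomorphicCoordinates

variable {T A B : Type*} [NormedAddCommGroup T] [NormedSpace ℝ T]
  [NormedAddCommGroup A] [NormedSpace ℝ A] [NormedAddCommGroup B] [NormedSpace ℝ B]
  [FiniteDimensional ℝ T] [FiniteDimensional ℝ A] [FiniteDimensional ℝ B]

omit [FiniteDimensional ℝ A] in
theorem fderiv_div_apply {g h : A → ℂ} {x : A} (hg : DifferentiableAt ℝ g x)
    (hh : DifferentiableAt ℝ h x) (hx : h x ≠ 0) (ξ : A) :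
    fderiv ℝ (fun y => g y / h y) x ξ =
      (h x * fderiv ℝ g x ξ - g x * fderiv ℝ h x ξ) / h x ^ 2 := by
  have hq : DifferentiableAt ℝ (fun y => g y / h y) x := by
    simp only [div_eq_mul_inv]
    exact hg.mul (hh.inv hx)
  have h1 : fderiv ℝ g x = fderiv ℝ (fun y => (g y / h y) * h y) x := by
    refine Filter.EventuallyEq.fderiv_eq ?_
    filter_upwards [hh.continuousAt.eventually_ne hx] with y hy
    rw [div_mul_cancel₀ _ hy]
  have h2 := DFunLike.congr_fun h1 ξ
  rw [fderiv_fun_mul hq hh] at h2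
  simp only [add_apply, smul_apply, smul_eq_mul] at h2
  rw [h2]
  field_simp
  ring

namespace EllipticPairOn

variable {L : T → A} {R : T → B} {O : Set T} {j : A → A →L[ℝ] A} {k : B → B →L[ℝ] B}

/-- Near a pair of points on one fibre of `R` with transverse planes `dR (ker dL)`, a point of the
fibre of `L` through the second one and a point of `A` determine a fibre of `R`. -/
theorem exists_pencil (h : EllipticPairOn L R O) (hT : Module.finrank ℝ T = 6)
    (hA : Module.finrank ℝ A = 4) (hB : Module.finrank ℝ B = 4) {a a₁ : T} (ha : a ∈ O)
    (ha₁ : a₁ ∈ O) (hR : R a₁ = R a)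
    (hdisj : ∀ y, y ∈ pairPlane R L a₁ → y ∈ pairPlane R L a → y = 0) :
    ∃ Z Z₁ : A → T, Z (L a) = a ∧ Z₁ (L a) = a₁ ∧ ∀ᶠ x in 𝓝 (L a),
      ContDiffAt ℝ ∞ Z x ∧ ContDiffAt ℝ ∞ Z₁ x ∧ L (Z x) = x ∧ L (Z₁ x) = L a₁ ∧
      R (Z x) = R (Z₁ x) ∧ ∀ y, y ∈ pairPlane R L (Z₁ x) → y ∈ pairPlane R L (Z x) → y = 0 := by
  -- The last component vanishes exactly when the two pointed curves have the same image under `R`.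
  -- Source and target have equal dimension 12, and disjointness of the two planes makes the
  -- derivative injective, so the two positions determine the pair locally.
  set M : T × T → A × A × B := fun z => (L z.1, L z.2, R z.1 - R z.2) with hM
  have hMd : ∀ z : T × T, z.1 ∈ O → z.2 ∈ O → ∀ u, fderiv ℝ M z u =
      (fderiv ℝ L z.1 u.1, fderiv ℝ L z.2 u.2, fderiv ℝ R z.1 u.1 - fderiv ℝ R z.2 u.2) := by
    intro z hz1 hz2 u
    have d1 := ((h.smooth_left _ hz1).differentiableAt (by simp)).hasFDerivAt.comp z
      (hasFDerivAt_fst (𝕜 := ℝ) (p := z))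
    have d2 := ((h.smooth_left _ hz2).differentiableAt (by simp)).hasFDerivAt.comp z
      (hasFDerivAt_snd (𝕜 := ℝ) (p := z))
    have d3 := ((h.smooth_right _ hz1).differentiableAt (by simp)).hasFDerivAt.comp z
      (hasFDerivAt_fst (𝕜 := ℝ) (p := z))
    have d4 := ((h.smooth_right _ hz2).differentiableAt (by simp)).hasFDerivAt.comp z
      (hasFDerivAt_snd (𝕜 := ℝ) (p := z))
    have d := d1.prodMk (d2.prodMk (d3.sub d4))
    have d' : fderiv ℝ M z = _ := HasFDerivAt.fderiv d
    rw [d']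
    rfl
  have hMs : ∀ᶠ z in 𝓝 (a, a₁), ContDiffAt ℝ ∞ M z := by
    filter_upwards [(h.isOpen.prod h.isOpen).mem_nhds (Set.mk_mem_prod ha ha₁)] with z hz
    have e1 := (h.smooth_left _ hz.1).comp z contDiffAt_fst
    have e2 := (h.smooth_left _ hz.2).comp z contDiffAt_snd
    have e3 := (h.smooth_right _ hz.1).comp z contDiffAt_fst
    have e4 := (h.smooth_right _ hz.2).comp z contDiffAt_snd
    exact e1.prodMk (e2.prodMk (e3.sub e4))
  have hinj : ∀ u, fderiv ℝ M (a, a₁) u = 0 → u = 0 := by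
    rintro ⟨u, u₁⟩ hu
    rw [hMd _ ha ha₁] at hu
    simp only [Prod.mk_eq_zero] at hu
    obtain ⟨h1, h2, h3⟩ := hu
    rw [sub_eq_zero] at h3
    have h4 : fderiv ℝ R a u = 0 :=
      hdisj _ (mem_pairPlane.2 ⟨u₁, h2, h3.symm⟩) (mem_pairPlane.2 ⟨u, h1, rfl⟩)
    rw [Prod.mk_eq_zero]
    exact ⟨h.transverse a ha u h1 h4, h.transverse a₁ ha₁ u₁ h2 (h3 ▸ h4)⟩
  obtain ⟨Φ, hΦ, haΦ, -, hΦs⟩ := exists_smooth_localInverse hMs hinj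
    (by simp only [Module.finrank_prod]; omega)
  have hMa : M (a, a₁) = (L a, L a₁, 0) := by simp [hM, hR]
  have hΦa : Φ.symm (L a, L a₁, 0) = (a, a₁) := by rw [← hMa, ← hΦ, Φ.left_inv haΦ]
  have htarget : (L a, L a₁, (0 : B)) ∈ Φ.target := by
    rw [← hMa, ← hΦ]
    exact Φ.map_source haΦ
  have hι : ∀ x : A, ContDiffAt ℝ ∞ (fun x : A => (x, L a₁, (0 : B))) x := fun x =>
    contDiffAt_id.prodMk contDiffAt_const
  refine ⟨fun x => (Φ.symm (x, L a₁, 0)).1, fun x => (Φ.symm (x, L a₁, 0)).2,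
    by simp [hΦa], by simp [hΦa], ?_⟩
  have ht : ∀ᶠ x in 𝓝 (L a), (x, L a₁, (0 : B)) ∈ Φ.target :=
    (hι (L a)).continuousAt.eventually_mem (Φ.open_target.mem_nhds htarget)
  have hcsymm : ContinuousAt (fun x : A => Φ.symm (x, L a₁, (0 : B))) (L a) :=
    ((hΦs _ htarget).comp (L a) (hι _)).continuousAt
  have hO : ∀ᶠ x in 𝓝 (L a), Φ.symm (x, L a₁, (0 : B)) ∈ O ×ˢ O :=
    hcsymm.eventually_mem ((h.isOpen.prod h.isOpen).mem_nhds (by rw [hΦa]; exact ⟨ha, ha₁⟩))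
  filter_upwards [ht, hO] with x hx hxO
  have hs := (hΦs _ hx).comp x (hι x)
  have hMx : M (Φ.symm (x, L a₁, 0)) = (x, L a₁, 0) := by rw [← hΦ, Φ.right_inv hx]
  simp only [hM, Prod.mk.injEq, sub_eq_zero] at hMx
  refine ⟨contDiffAt_fst.comp x hs, contDiffAt_snd.comp x hs, hMx.1, hMx.2.1, hMx.2.2, ?_⟩
  intro y hy hy'
  obtain ⟨u₁, hu₁, rfl⟩ := mem_pairPlane.1 hy
  obtain ⟨u, hu, huu⟩ := mem_pairPlane.1 hy'
  set z := Φ.symm (x, L a₁, 0) with hz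
  have hzs : z ∈ Φ.source := Φ.map_target hx
  -- A common vector of the nearby planes is a kernel vector of the derivative of `M`. It vanishes
  -- because `M` has a differentiable local inverse here.
  have h0 : fderiv ℝ M z (u, u₁) = 0 := by
    rw [hMd _ hxO.1 hxO.2]
    simp [hu, hu₁, huu]
  have hMz : M z = (x, L a₁, 0) := by rw [hz, ← hΦ, Φ.right_inv hx]
  have hMdz : DifferentiableAt ℝ M z := by
    have e1 := (h.smooth_left _ hxO.1).comp z contDiffAt_fst
    have e2 := (h.smooth_left _ hxO.2).comp z contDiffAt_snd
    have e3 := (h.smooth_right _ hxO.1).comp z contDiffAt_fst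
    have e4 := (h.smooth_right _ hxO.2).comp z contDiffAt_snd
    exact (e1.prodMk (e2.prodMk (e3.sub e4))).differentiableAt (by simp)
  have hcomp : fderiv ℝ (Φ.symm ∘ M) z = ContinuousLinearMap.id ℝ (T × T) := by
    rw [← fderiv_id (x := z)]
    refine Filter.EventuallyEq.fderiv_eq ?_
    filter_upwards [Φ.open_source.mem_nhds hzs] with z' hz'
    simp [← hΦ, Φ.left_inv hz']
  rw [fderiv_comp z (by rw [hMz]; exact (hΦs _ hx).differentiableAt (by simp)) hMdz] at hcomp
  have h1 := DFunLike.congr_fun hcomp (u, u₁)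
  simp only [ContinuousLinearMap.comp_apply, h0, map_zero, ContinuousLinearMap.id_apply] at h1
  rw [eq_comm, Prod.mk_eq_zero] at h1
  rw [h1.2, map_zero]

/-- A local holomorphic function whose differential at `L a` vanishes at most on `dL (ker dR)`. -/
theorem exists_holomorphic_function (h : EllipticPairOn L R O) (hT : Module.finrank ℝ T = 6)
    (hA : Module.finrank ℝ A = 4) (hB : Module.finrank ℝ B = 4)
    (hj : IsComplexPair L R O j) (hk : IsComplexPair R L O k) {a : T} (ha : a ∈ O) :
    ∃ f : A → ℂ, (∀ᶠ x in 𝓝 (L a), ContDiffAt ℝ ∞ f x ∧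
        ∀ ξ, fderiv ℝ f x (j x ξ) = Complex.I * fderiv ℝ f x ξ) ∧
      ∀ ξ, fderiv ℝ f (L a) ξ = 0 → ξ ∈ pairPlane L R a := by
  obtain ⟨ε, hε, hsa⟩ := h.exists_isSignAt hT hA hB hj hk ha
  have hsev := h.eventually_isSignAt hT hA hB hj hk ha hε hsa
  -- The second position on the curve is close enough to `a` for the same sign ε to hold around it.
  obtain ⟨a₁, ⟨hRa, hdisj⟩, ha₁, hs₁⟩ :=
    ((h.symm.frequently_disjoint_pairPlane hT hB hA hk ha).and_eventually
      ((h.eventually_mem ha).and hsev.eventually_nhds)).exists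
  obtain ⟨Z, Z₁, hZa, hZ₁a, hZ⟩ := h.exists_pencil hT hA hB ha ha₁ hRa hdisj
  obtain ⟨v₀, hv₀, hv₀0⟩ := exists_ker_ne_zero (fderiv ℝ R a₁).toLinearMap
    (h.surjective_right a₁ ha₁) hT hB
  obtain ⟨v, hva, hv⟩ := h.exists_section ha₁ hv₀
  set s : T → A := fun z => fderiv ℝ L z (v z) with hs
  have hsP : ∀ᶠ z in 𝓝 a₁, s z ∈ pairPlane L R z := hv.mono fun z hz =>
    mem_pairPlane.2 ⟨_, hz.1, rfl⟩
  have hssm : ∀ᶠ z in 𝓝 a₁, ContDiffAt ℝ ∞ s z := by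
    filter_upwards [hv, h.eventually_contDiffAt_fderiv_left ha₁] with z h1 h2
    exact h2.clm_apply h1.2
  have hs0 : s a₁ ≠ 0 := fun h0 =>
    hv₀0 (h.transverse a₁ ha₁ v₀ (by simpa [hs, hva] using h0) hv₀)
  have hsq := hj.sq_eq_neg a₁ ha₁
  -- The ratio β/α is an affine coordinate on the complex lines in the fixed tangent space at `L
  -- a₁`, centred at the plane of `a₁`.
  obtain ⟨α, hα, hαs⟩ := exists_complexFunctional_ne_zero (j (L a₁)) hsq hs0
  obtain ⟨β, hβ, hβP⟩ := exists_complexFunctional_ker_eq (j (L a₁)) hsq hA (pairPlane L R a₁)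
    (hj.map_mem a₁ ha₁) (h.finrank_pairPlane hT hB ha₁)
  have hαev : ∀ᶠ z in 𝓝 a₁, α (s z) ≠ 0 :=
    (α.continuous.continuousAt.comp hssm.self_of_nhds.continuousAt).eventually_ne hαs
  have hderiv : ∀ x, ContDiffAt ℝ ∞ Z₁ x → ContDiffAt ℝ ∞ s (Z₁ x) → α (s (Z₁ x)) ≠ 0 → ∀ ξ,
      fderiv ℝ (fun x => β (s (Z₁ x)) / α (s (Z₁ x))) x ξ =
        (α (s (Z₁ x)) * β (fderiv ℝ s (Z₁ x) (fderiv ℝ Z₁ x ξ)) -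
          β (s (Z₁ x)) * α (fderiv ℝ s (Z₁ x) (fderiv ℝ Z₁ x ξ))) / α (s (Z₁ x)) ^ 2 := by
    intro x hZx hsx hαx ξ
    have hd : HasFDerivAt (fun x => s (Z₁ x)) ((fderiv ℝ s (Z₁ x)).comp (fderiv ℝ Z₁ x)) x :=
      (hsx.differentiableAt (by simp)).hasFDerivAt.comp x
        (hZx.differentiableAt (by simp)).hasFDerivAt
    have hdα : HasFDerivAt (fun x => α (s (Z₁ x))) _ x := α.hasFDerivAt.comp x hd
    have hdβ : HasFDerivAt (fun x => β (s (Z₁ x))) _ x := β.hasFDerivAt.comp x hd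
    rw [fderiv_div_apply hdβ.differentiableAt hdα.differentiableAt hαx, hdα.fderiv, hdβ.fderiv]
    rfl
  have hZt : Filter.Tendsto Z (𝓝 (L a)) (𝓝 a) := by
    have := hZ.self_of_nhds.1.continuousAt
    rwa [ContinuousAt, hZa] at this
  have hZ₁t : Filter.Tendsto Z₁ (𝓝 (L a)) (𝓝 a₁) := by
    have := hZ.self_of_nhds.2.1.continuousAt
    rwa [ContinuousAt, hZ₁a] at this
  have hZd : ∀ᶠ x in 𝓝 (L a), Z x ∈ O → Z₁ x ∈ O → ∀ ξ,
      fderiv ℝ L (Z x) (fderiv ℝ Z x ξ) = ξ ∧ fderiv ℝ L (Z₁ x) (fderiv ℝ Z₁ x ξ) = 0 ∧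
      fderiv ℝ R (Z x) (fderiv ℝ Z x ξ) = fderiv ℝ R (Z₁ x) (fderiv ℝ Z₁ x ξ) := by
    filter_upwards [hZ.eventually_nhds] with x hx hO hO₁ ξ
    have hxx := hx.self_of_nhds
    have dZ := hxx.1.differentiableAt (by simp)
    have dZ₁ := hxx.2.1.differentiableAt (by simp)
    have dL := (h.smooth_left _ hO).differentiableAt (by simp)
    have dL₁ := (h.smooth_left _ hO₁).differentiableAt (by simp)
    have dR := (h.smooth_right _ hO).differentiableAt (by simp)
    have dR₁ := (h.smooth_right _ hO₁).differentiableAt (by simp)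
    refine ⟨?_, ?_, ?_⟩
    · have e : L ∘ Z =ᶠ[𝓝 x] id := hx.mono fun y hy => hy.2.2.1
      have := DFunLike.congr_fun (e.fderiv_eq (𝕜 := ℝ)) ξ
      rw [fderiv_comp x dL dZ] at this
      simpa using this
    · have e : L ∘ Z₁ =ᶠ[𝓝 x] fun _ => L a₁ := hx.mono fun y hy => hy.2.2.2.1
      have := DFunLike.congr_fun (e.fderiv_eq (𝕜 := ℝ)) ξ
      rw [fderiv_comp x dL₁ dZ₁] at this
      simpa using this
    · have e : R ∘ Z =ᶠ[𝓝 x] R ∘ Z₁ := hx.mono fun y hy => hy.2.2.2.2.1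
      have := DFunLike.congr_fun (e.fderiv_eq (𝕜 := ℝ)) ξ
      rw [fderiv_comp x dR dZ, fderiv_comp x dR₁ dZ₁] at this
      simpa using this
  refine ⟨fun x => β (s (Z₁ x)) / α (s (Z₁ x)), ?_, ?_⟩
  · filter_upwards [hZ, hZd, hZt.eventually (h.eventually_mem ha), hZt.eventually hsev,
      hZ₁t.eventually (h.eventually_mem ha₁), hZ₁t.eventually hs₁, hZ₁t.eventually hαev,
      hZ₁t.eventually hssm, hZ₁t.eventually hv.eventually_nhds, hZ₁t.eventually hsP]
      with x hx hxd hO hsx hO₁ hs₁x hαx hssx hvx hsPx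
    obtain ⟨hZs, hZ₁s, hLZ, hLZ₁, hRR, hdis⟩ := hx
    have hcs : ContDiffAt ℝ ∞ (fun x => s (Z₁ x)) x := hssx.comp x hZ₁s
    refine ⟨?_, fun ξ => ?_⟩
    · simp only [div_eq_mul_inv]
      exact (β.contDiff.contDiffAt.comp x hcs).mul ((α.contDiff.contDiffAt.comp x hcs).inv hαx)
    · rw [hderiv x hZ₁s hssx hαx, hderiv x hZ₁s hssx hαx]
      obtain ⟨h1, h2, h3⟩ := hxd hO hO₁ ξ
      obtain ⟨h1', h2', h3'⟩ := hxd hO hO₁ (j x ξ)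
      set w := fderiv ℝ Z₁ x ξ
      set w' := fderiv ℝ Z₁ x (j x ξ)
      have hsign := hsx (fderiv ℝ Z x ξ) (fderiv ℝ Z x (j x ξ)) (by rw [h1', hLZ, h1])
      rw [h3, h3', hRR] at hsign
      -- The deviation from ε `k`-linearity lies in the plane at `Z x` by the sign property, and in
      -- the plane at `Z₁ x` because `w` and `w'` are tangent to the fibre of L. These planes meet
      -- only in 0, so the deviation vanishes.
      have hmem : fderiv ℝ R (Z₁ x) w' - ε • k (R (Z₁ x)) (fderiv ℝ R (Z₁ x) w) ∈
          pairPlane R L (Z₁ x) :=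
        Submodule.sub_mem _ (mem_pairPlane.2 ⟨w', h2', rfl⟩)
          (Submodule.smul_mem _ _ (hk.map_mem _ hO₁ _ (mem_pairPlane.2 ⟨w, h2, rfl⟩)))
      have hww := sub_eq_zero.1 (hdis _ hmem hsign)
      have hlin := h.fderiv_section_complexLinear hk hO₁ hε hs₁x (hj.map_mem _ hO₁)
        (hvx.self_of_nhds.2.differentiableAt (by simp)) (hvx.mono fun z hz => hz.1) h2 h2' hww
      have hs0x : s (Z₁ x) ≠ 0 := fun h0 => hαx (by rw [h0, map_zero])
      obtain ⟨c, d, hcd⟩ := exists_eq_smul_add_smul_of_mem_complexLine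
        (j (L (Z₁ x))).toLinearMap (pairPlane L R (Z₁ x)) (hj.sq_eq_neg _ hO₁) (hj.map_mem _ hO₁)
        (h.finrank_pairPlane hT hB hO₁) hsPx hs0x hlin
      -- The remaining error is a complex multiple of `s`, which the derivative of β/α does not see.
      -- Since `L (Z₁ x)` is constantly `L a₁`, the functionals are complex linear for the same `j`
      -- throughout.
      rw [sub_eq_iff_eq_add, hLZ₁] at hcd
      rw [show fderiv ℝ s (Z₁ x) w' = _ from hcd]
      change (_ * β (c • s (Z₁ x) + d • j (L a₁) (s (Z₁ x)) + j (L a₁) (fderiv ℝ s (Z₁ x) w)) -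
        _ * α (c • s (Z₁ x) + d • j (L a₁) (s (Z₁ x)) + j (L a₁) (fderiv ℝ s (Z₁ x) w))) / _ = _
      simp only [map_add, map_smul, hα, hβ, Complex.real_smul]
      ring
  · intro ξ hξ
    have hxd := hZd.self_of_nhds (by rw [hZa]; exact ha) (by rw [hZ₁a]; exact ha₁) ξ
    rw [hderiv _ hZ.self_of_nhds.2.1 (by rw [hZ₁a]; exact hssm.self_of_nhds)
      (by rw [hZ₁a]; exact hαs)] at hξ
    rw [hZ₁a] at hξ hxd
    rw [hZa] at hxd
    obtain ⟨h1, h2, h3⟩ := hxd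
    set w := fderiv ℝ Z₁ (L a) ξ
    -- At `a₁` the value of β on `s` is 0, so vanishing of the differential means that the
    -- derivative of `s` along `w` is tangent; ellipticity forces `w = 0`.
    have hw0 : w = 0 := by
      by_contra hw0
      refine h.fderiv_section_notMem ha₁ hsP (hssm.self_of_nhds.differentiableAt (by simp)) hs0 h2
        hw0 ((hβP _).1 ?_)
      rw [(hβP _).2 hsP.self_of_nhds] at hξ
      simpa [hαs] using hξ
    rw [hw0, map_zero] at h3
    exact mem_pairPlane.2 ⟨_, h3, h1⟩

/-- If both plane fields of an elliptic pair consist of complex lines of almost complex structures,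
then there are local holomorphic coordinates. -/
theorem exists_holomorphic_coordinates (h : EllipticPairOn L R O) (hT : Module.finrank ℝ T = 6)
    (hA : Module.finrank ℝ A = 4) (hB : Module.finrank ℝ B = 4)
    (hj : IsComplexPair L R O j) (hk : IsComplexPair R L O k) {a : T} (ha : a ∈ O) :
    ∃ φ : A → ℂ × ℂ, (∀ᶠ x in 𝓝 (L a), ContDiffAt ℝ ∞ φ x ∧
        ∀ ξ, fderiv ℝ φ x (j x ξ) = Complex.I • fderiv ℝ φ x ξ) ∧
      ∀ ξ, fderiv ℝ φ (L a) ξ = 0 → ξ = 0 := by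
  -- A second curve through the same point, with transverse tangent plane, supplies the second
  -- coordinate.
  obtain ⟨a', ⟨hLa, hdisj⟩, ha'⟩ := ((h.frequently_disjoint_pairPlane hT hA hB hj ha).and_eventually
      (h.eventually_mem ha)).exists
  obtain ⟨f, hf, hfker⟩ := h.exists_holomorphic_function hT hA hB hj hk ha
  obtain ⟨g, hg, hgker⟩ := h.exists_holomorphic_function hT hA hB hj hk ha'
  rw [hLa] at hg hgker
  have hd : ∀ x, ContDiffAt ℝ ∞ f x → ContDiffAt ℝ ∞ g x → ∀ ξ,
      fderiv ℝ (fun x => (f x, g x)) x ξ = (fderiv ℝ f x ξ, fderiv ℝ g x ξ) := by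
    intro x hfx hgx ξ
    rw [((hfx.differentiableAt (by simp)).hasFDerivAt.prodMk
      (hgx.differentiableAt (by simp)).hasFDerivAt).fderiv]
    rfl
  refine ⟨fun x => (f x, g x), ?_, ?_⟩
  · filter_upwards [hf, hg] with x hfx hgx
    refine ⟨hfx.1.prodMk hgx.1, fun ξ => ?_⟩
    rw [hd x hfx.1 hgx.1, hd x hfx.1 hgx.1, hfx.2, hgx.2]
    rfl
  · intro ξ hξ
    rw [hd _ hf.self_of_nhds.1 hg.self_of_nhds.1, Prod.mk_eq_zero] at hξ
    exact hdisj ξ (hgker ξ hξ.2) (hfker ξ hξ.1)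

end EllipticPairOn

end HolomorphicCoordinates

/-! ### Derivatives and plane fields read in charts. -/

section Charts

variable {V W : Type*} [NormedAddCommGroup V] [NormedSpace ℝ V]
  [NormedAddCommGroup W] [NormedSpace ℝ W]
  {M : Type*} [TopologicalSpace M] [ChartedSpace V M] [IsManifold 𝓘(ℝ, V) ∞ M]
  {N : Type*} [TopologicalSpace N] [ChartedSpace W N] [IsManifold 𝓘(ℝ, W) ∞ N]

variable (V) in
/-- The derivative at `x` of the chart centred at `x₀`. -/
def chartDeriv (x₀ x : M) : TangentSpace 𝓘(ℝ, V) x →L[ℝ] V :=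
  mfderiv 𝓘(ℝ, V) 𝓘(ℝ, V) (extChartAt 𝓘(ℝ, V) x₀) x

variable (V) in
/-- The inverse of the derivative at `x` of the chart centred at `x₀`. -/
def chartDerivInv (x₀ x : M) : V →L[ℝ] TangentSpace 𝓘(ℝ, V) x :=
  (chartDeriv V x₀ x).inverse

theorem isInvertible_chartDeriv {x₀ x : M} (hx : x ∈ (chartAt V x₀).source) :
    (chartDeriv V x₀ x).IsInvertible := by
  have : IsManifold 𝓘(ℝ, V) 1 M := IsManifold.of_le (n := ∞) (by simp)
  exact isInvertible_mfderiv_extChartAt (by simpa using hx)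

theorem chartDeriv_chartDerivInv {x₀ x : M} (hx : x ∈ (chartAt V x₀).source) (y : V) :
    chartDeriv V x₀ x (chartDerivInv V x₀ x y) = y := by
  obtain ⟨e, he⟩ := isInvertible_chartDeriv hx
  simp [chartDerivInv, ← he]

theorem chartDerivInv_chartDeriv {x₀ x : M} (hx : x ∈ (chartAt V x₀).source)
    (v : TangentSpace 𝓘(ℝ, V) x) : chartDerivInv V x₀ x (chartDeriv V x₀ x v) = v := by
  obtain ⟨e, he⟩ := isInvertible_chartDeriv hx
  simp [chartDerivInv, ← he]

theorem chartDeriv_self (x : M) (v : TangentSpace 𝓘(ℝ, V) x) : chartDeriv V x x v = v := by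
  have : IsManifold 𝓘(ℝ, V) 1 M := IsManifold.of_le (n := ∞) (by simp)
  have h := mfderiv_extChartAt_self (I := 𝓘(ℝ, V)) (x := x)
  exact DFunLike.congr_fun h v

theorem chartDeriv_eq_zero_iff {x₀ x : M} (hx : x ∈ (chartAt V x₀).source)
    (v : TangentSpace 𝓘(ℝ, V) x) : chartDeriv V x₀ x v = 0 ↔ v = 0 := by
  refine ⟨fun h => ?_, fun h => by rw [h, map_zero]⟩
  rw [← chartDerivInv_chartDeriv hx v, h, map_zero]

theorem trivializationAt_snd {x₀ x : M} (hx : x ∈ (chartAt V x₀).source)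
    (v : TangentSpace 𝓘(ℝ, V) x) :
    (trivializationAt V (TangentSpace 𝓘(ℝ, V) : M → Type _) x₀
      (⟨x, v⟩ : TangentBundle 𝓘(ℝ, V) M)).2 = chartDeriv V x₀ x v := by
  have : IsManifold 𝓘(ℝ, V) 1 M := IsManifold.of_le (n := ∞) (by simp)
  have h := TangentBundle.continuousLinearMapAt_trivializationAt (I := 𝓘(ℝ, V)) hx
  have h' := DFunLike.congr_fun h v
  have h2 := congrFun (Bundle.Trivialization.coe_linearMapAt_of_mem (R := ℝ)
    (trivializationAt V (TangentSpace 𝓘(ℝ, V) : M → Type _) x₀) (b := x) (by simpa using hx)) v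
  exact h2.symm.trans h'

variable (V W) in
/-- A map between manifolds, read in the charts centred at `z₀` and `x₀`. -/
def localRep (f : N → M) (z₀ : N) (x₀ : M) : W → V :=
  extChartAt 𝓘(ℝ, V) x₀ ∘ f ∘ (extChartAt 𝓘(ℝ, W) z₀).symm

omit [IsManifold 𝓘(ℝ, V) ∞ M] [IsManifold 𝓘(ℝ, W) ∞ N] in
theorem localRep_chart (f : N → M) {z₀ z : N} (x₀ : M) (hz : z ∈ (chartAt W z₀).source) :
    localRep V W f z₀ x₀ (extChartAt 𝓘(ℝ, W) z₀ z) = extChartAt 𝓘(ℝ, V) x₀ (f z) := by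
  simp only [localRep, Function.comp_apply]
  rw [(extChartAt 𝓘(ℝ, W) z₀).left_inv (by simpa using hz)]

theorem contDiffAt_localRep {f : N → M} (hf : ContMDiff 𝓘(ℝ, W) 𝓘(ℝ, V) ∞ f) {z₀ z : N} {x₀ : M}
    (hz : z ∈ (chartAt W z₀).source) (hx : f z ∈ (chartAt V x₀).source) :
    ContDiffAt ℝ ∞ (localRep V W f z₀ x₀) (extChartAt 𝓘(ℝ, W) z₀ z) := by
  have h := ((contMDiffAt_iff_of_mem_source hz hx).1 hf.contMDiffAt).2
  simpa using! h

theorem mdifferentiableAt_chart {x₀ x : M} (hx : x ∈ (chartAt V x₀).source) :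
    MDifferentiableAt 𝓘(ℝ, V) 𝓘(ℝ, V) (extChartAt 𝓘(ℝ, V) x₀) x := by
  have : IsManifold 𝓘(ℝ, V) 1 M := IsManifold.of_le (n := ∞) (by simp)
  exact mdifferentiableAt_extChartAt hx

/-- The derivative of a function of the chart coordinates. -/
theorem mfderiv_comp_chart {F : Type*} [NormedAddCommGroup F] [NormedSpace ℝ F]
    {g : M → F} {G : V → F} {x₀ x : M} (hx : x ∈ (chartAt V x₀).source)
    (hG : DifferentiableAt ℝ G (extChartAt 𝓘(ℝ, V) x₀ x))
    (hg : ∀ᶠ y in 𝓝 x, g y = G (extChartAt 𝓘(ℝ, V) x₀ y)) (v : TangentSpace 𝓘(ℝ, V) x) :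
    mfderiv 𝓘(ℝ, V) 𝓘(ℝ, F) g x v = fderiv ℝ G (extChartAt 𝓘(ℝ, V) x₀ x) (chartDeriv V x₀ x v) := by
  have h1 : g =ᶠ[𝓝 x] G ∘ extChartAt 𝓘(ℝ, V) x₀ := hg
  rw [h1.mfderiv_eq, mfderiv_comp x hG.mdifferentiableAt (mdifferentiableAt_chart hx),
    mfderiv_eq_fderiv]
  rfl

omit [NormedSpace ℝ V] [IsManifold 𝓘(ℝ, V) ∞ M] in
theorem eventually_mem_chart_source {x₀ x : M} (hx : x ∈ (chartAt V x₀).source) :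
    ∀ᶠ y in 𝓝 x, y ∈ (chartAt V x₀).source :=
  (chartAt V x₀).open_source.mem_nhds hx

theorem fderiv_localRep {f : N → M} (hf : ContMDiff 𝓘(ℝ, W) 𝓘(ℝ, V) ∞ f) {z₀ z : N} {x₀ : M}
    (hz : z ∈ (chartAt W z₀).source) (hx : f z ∈ (chartAt V x₀).source)
    (u : TangentSpace 𝓘(ℝ, W) z) :
    fderiv ℝ (localRep V W f z₀ x₀) (extChartAt 𝓘(ℝ, W) z₀ z) (chartDeriv W z₀ z u) =
      chartDeriv V x₀ (f z) (mfderiv 𝓘(ℝ, W) 𝓘(ℝ, V) f z u) := by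
  rw [← mfderiv_comp_chart (g := extChartAt 𝓘(ℝ, V) x₀ ∘ f) hz
    ((contDiffAt_localRep hf hz hx).differentiableAt (by simp))
    ((eventually_mem_chart_source hz).mono fun y hy => (localRep_chart f x₀ hy).symm)]
  rw [mfderiv_comp z (mdifferentiableAt_chart hx) (hf.mdifferentiableAt (by simp))]
  rfl

theorem mem_pairPlane_localRep {V' : Type*} [NormedAddCommGroup V'] [NormedSpace ℝ V']
    {M' : Type*} [TopologicalSpace M'] [ChartedSpace V' M'] [IsManifold 𝓘(ℝ, V') ∞ M']
    {f : N → M} (hf : ContMDiff 𝓘(ℝ, W) 𝓘(ℝ, V) ∞ f)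
    {g : N → M'} (hg : ContMDiff 𝓘(ℝ, W) 𝓘(ℝ, V') ∞ g) {z₀ z : N} {x₀ : M} {y₀ : M'}
    (hz : z ∈ (chartAt W z₀).source) (hx : f z ∈ (chartAt V x₀).source)
    (hy : g z ∈ (chartAt V' y₀).source) (v : TangentSpace 𝓘(ℝ, V) (f z)) :
    chartDeriv V x₀ (f z) v ∈
      pairPlane (localRep V W f z₀ x₀) (localRep V' W g z₀ y₀) (extChartAt 𝓘(ℝ, W) z₀ z) ↔
    ∃ u, mfderiv 𝓘(ℝ, W) 𝓘(ℝ, V') g z u = 0 ∧ mfderiv 𝓘(ℝ, W) 𝓘(ℝ, V) f z u = v := by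
  rw [mem_pairPlane]
  constructor
  · rintro ⟨w, hw, hwv⟩
    rw [← chartDeriv_chartDerivInv hz w] at hw hwv
    rw [fderiv_localRep hg hz hy, chartDeriv_eq_zero_iff hy] at hw
    rw [fderiv_localRep hf hz hx] at hwv
    refine ⟨_, hw, ?_⟩
    have := congrArg (chartDerivInv V x₀ (f z)) hwv
    rwa [chartDerivInv_chartDeriv hx, chartDerivInv_chartDeriv hx] at this
  · rintro ⟨u, hu, rfl⟩
    exact ⟨chartDeriv W z₀ z u, by rw [fderiv_localRep hg hz hy, hu, map_zero],
      fderiv_localRep hf hz hx u⟩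

omit [IsManifold 𝓘(ℝ, W) ∞ N] in
/-- A section of the pulled back tangent bundle, smooth in the coordinates of a chart, is smooth. -/
theorem contMDiffOn_chartDerivInv {f : N → M} {U : Set N} {x₀ : M} {g : N → V}
    (hf : ContMDiffOn 𝓘(ℝ, W) 𝓘(ℝ, V) ∞ f U) (hU : ∀ z ∈ U, f z ∈ (chartAt V x₀).source)
    (hg : ContMDiffOn 𝓘(ℝ, W) 𝓘(ℝ, V) ∞ g U) :
    ContMDiffOn 𝓘(ℝ, W) 𝓘(ℝ, V).tangent ∞
      (fun z => (⟨f z, chartDerivInv V x₀ (f z) (g z)⟩ : TangentBundle 𝓘(ℝ, V) M)) U := by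
  have : ContMDiffVectorBundle ∞ V (TangentSpace 𝓘(ℝ, V) : M → Type _) 𝓘(ℝ, V) :=
    TangentBundle.contMDiffVectorBundle (n := ∞) (h := by simpa)
  refine ((trivializationAt V (TangentSpace 𝓘(ℝ, V) : M → Type _) x₀).contMDiffOn_iff ?_).2
    ⟨hf, hg.congr fun z hz => ?_⟩
  · intro z hz
    rw [Bundle.Trivialization.mem_source]
    simpa using hU z hz
  · rw [trivializationAt_snd (hU z hz), chartDeriv_chartDerivInv (hU z hz)]

end Charts

/-! ### Invariance of ellipticity under change of coordinates. -/

section EllipticChange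

variable {T A A' B : Type*} [NormedAddCommGroup T] [NormedSpace ℝ T]
  [NormedAddCommGroup A] [NormedSpace ℝ A] [NormedAddCommGroup A'] [NormedSpace ℝ A']
  [NormedAddCommGroup B] [NormedSpace ℝ B]

/-- Ellipticity does not depend on the coordinates of the target. -/
theorem EllipticAt.of_eventuallyEq_comp {L : T → A} {L' : T → A'} {R : T → B} {ψ : A' → A} {a : T}
    (h : EllipticAt L' R a) (hL : ContDiffAt ℝ ∞ L a) (hL' : ContDiffAt ℝ ∞ L' a)
    (hψ : ContDiffAt ℝ ∞ ψ (L' a)) (hψ0 : ∀ y, fderiv ℝ ψ (L' a) y = 0 → y = 0)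
    (hLψ : ∀ᶠ z in 𝓝 a, L z = ψ (L' z)) : EllipticAt L R a := by
  have hev : ∀ᶠ z in 𝓝 a, ∀ u, fderiv ℝ L z u = fderiv ℝ ψ (L' z) (fderiv ℝ L' z u) := by
    have h1 : ∀ᶠ z in 𝓝 a, ContDiffAt ℝ 1 L' z := (hL'.of_le (by simp)).eventually (by simp)
    have h2 : ∀ᶠ z in 𝓝 a, ContDiffAt ℝ 1 ψ (L' z) :=
      hL'.continuousAt.eventually ((hψ.of_le (by simp)).eventually (by simp))
    filter_upwards [hLψ.eventually_nhds, h1, h2] with z hz h1z h2z u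
    have e : L =ᶠ[𝓝 z] ψ ∘ L' := hz
    rw [e.fderiv_eq, fderiv_comp z (h2z.differentiableAt (by simp))
      (h1z.differentiableAt (by simp))]
    rfl
  have hdL : DifferentiableAt ℝ (fderiv ℝ L) a :=
    (hL.fderiv_right (m := 1) (one_add_one_eq_two.trans_le two_le_infty)).differentiableAt (by simp)
  have hdL' : DifferentiableAt ℝ (fderiv ℝ L') a :=
    (hL'.fderiv_right (m := 1) (one_add_one_eq_two.trans_le two_le_infty)).differentiableAt
      (by simp)
  have hdψ : DifferentiableAt ℝ (fderiv ℝ ψ) (L' a) :=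
    (hψ.fderiv_right (m := 1) (one_add_one_eq_two.trans_le two_le_infty)).differentiableAt (by simp)
  have hdLψ : DifferentiableAt ℝ (fun z => fderiv ℝ ψ (L' z)) a :=
    hdψ.comp a (hL'.differentiableAt (by simp))
  have hker : ∀ u, fderiv ℝ L a u = 0 ↔ fderiv ℝ L' a u = 0 := fun u => by
    rw [hev.self_of_nhds u]
    exact ⟨hψ0 _, fun h => by rw [h, map_zero]⟩
  -- The second derivative of `ψ` enters only through the image of `w`, which is 0.
  have h2 : ∀ u w, fderiv ℝ L' a w = 0 → fderiv ℝ (fderiv ℝ L) a w u =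
      fderiv ℝ ψ (L' a) (fderiv ℝ (fderiv ℝ L') a w u) := by
    intro u w hw
    have e1 : fderiv ℝ (fun z => fderiv ℝ L z u) a w = fderiv ℝ (fderiv ℝ L) a w u := by
      rw [fderiv_clm_apply hdL (differentiableAt_const u)]; simp
    have e2 : fderiv ℝ (fun z => fderiv ℝ L' z u) a w = fderiv ℝ (fderiv ℝ L') a w u := by
      rw [fderiv_clm_apply hdL' (differentiableAt_const u)]; simp
    have e3 : fderiv ℝ (fun z => fderiv ℝ ψ (L' z)) a w = 0 := by
      rw [show (fun z => fderiv ℝ ψ (L' z)) = fderiv ℝ ψ ∘ L' from rfl,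
        fderiv_comp a hdψ (hL'.differentiableAt (by simp))]
      simp [hw]
    rw [← e1, Filter.EventuallyEq.fderiv_eq (hev.mono fun z hz => hz u),
      fderiv_clm_apply hdLψ (hdL'.clm_apply (differentiableAt_const u))]
    simp [e2, e3]
  intro v w hv hw hv0 hw0 p q hp hq hpq
  have hw' := (hker w).1 hw
  refine h v w hv hw' hv0 hw0 p q ?_ hq ?_
  · rw [← sub_eq_zero]
    apply hψ0
    rw [map_sub, ← hev.self_of_nhds, hp, hL.fderiv_fderiv_symm, h2 v w hw',
      hL'.fderiv_fderiv_symm, sub_self]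
  · convert! hpq using 2
    ext u
    exact (hker u).symm

end EllipticChange

/-! ### Curve families as elliptic pairs. -/

section Families

variable {X : Type*} [TopologicalSpace X] [ChartedSpace R4 X] [IsManifold (𝓡 4) ∞ X]
variable {E : Type*} [TopologicalSpace E] [ChartedSpace R6 E] [IsManifold (𝓡 6) ∞ E]
variable {Y : Type*} [TopologicalSpace Y] [ChartedSpace R4 Y] [IsManifold (𝓡 4) ∞ Y]
variable {Z : Type*} [TopologicalSpace Z] [ChartedSpace R6 Z] [IsManifold (𝓡 6) ∞ Z]
variable {p : E → X} {P : ∀ e, Submodule ℝ (TangentSpace (𝓡 4) (p e))} {τ : Z → E} {ρ : Z → Y}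

theorem finrank_R4 : Module.finrank ℝ R4 = 4 := by simp

theorem finrank_R6 : Module.finrank ℝ R6 = 6 := by simp

theorem IsPseudocomplex.finrank_plane (hE : IsPseudocomplex p P) (e : E) :
    Module.finrank ℝ (P e) = 2 := by
  obtain ⟨U, -, he, s, t, -, -, h⟩ := hE.smooth_planes e
  obtain ⟨hli, hspan⟩ := h e he
  have h1 := finrank_span_eq_card hli
  rw [Matrix.range_cons, Matrix.range_cons, Matrix.range_empty, Set.union_empty,
    Set.singleton_union, hspan] at h1
  simpa using h1

namespace IsCurveFamily

theorem contMDiff_pointMap (hfam : IsCurveFamily p P τ ρ) (hE : IsPseudocomplex p P) :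
    ContMDiff (𝓡 6) (𝓡 4) ∞ (pointMap p τ) :=
  hE.contMDiff.comp hfam.localDiffeo.contMDiff

theorem bijective_mfderiv (hfam : IsCurveFamily p P τ ρ) (z : Z) :
    Function.Bijective (mfderiv (𝓡 6) (𝓡 6) τ z) := by
  have h := (hfam.localDiffeo z).mfderivToContinuousLinearEquiv_coe (by simp)
  rw [← h]
  exact ContinuousLinearEquiv.bijective _

theorem mfderiv_pointMap (hfam : IsCurveFamily p P τ ρ) (hE : IsPseudocomplex p P) (z : Z)
    (u : TangentSpace (𝓡 6) z) : mfderiv (𝓡 6) (𝓡 4) (pointMap p τ) z u =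
      mfderiv (𝓡 6) (𝓡 4) p (τ z) (mfderiv (𝓡 6) (𝓡 6) τ z u) := by
  have h := mfderiv_comp z (hE.contMDiff.mdifferentiableAt (x := τ z) (by simp))
    (hfam.localDiffeo.contMDiff.mdifferentiableAt (x := z) (by simp))
  exact DFunLike.congr_fun h u

theorem surjective_mfderiv_pointMap (hfam : IsCurveFamily p P τ ρ) (hE : IsPseudocomplex p P)
    (z : Z) : Function.Surjective (mfderiv (𝓡 6) (𝓡 4) (pointMap p τ) z) := by
  intro y
  obtain ⟨w, hw⟩ := hE.submersion (τ z) y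
  obtain ⟨u, rfl⟩ := (hfam.bijective_mfderiv z).2 w
  exact ⟨u, (hfam.mfderiv_pointMap hE z u).trans hw⟩

theorem mem_curvePlane (hfam : IsCurveFamily p P τ ρ) (z : Z)
    (v : TangentSpace (𝓡 4) (pointMap p τ z)) :
    v ∈ curvePlane p P τ z ↔ ∃ u, mfderiv (𝓡 6) (𝓡 4) ρ z u = 0 ∧
      mfderiv (𝓡 6) (𝓡 4) (pointMap p τ) z u = v := by
  rw [← hfam.tangent z]
  rfl

theorem chartDeriv_mem_pairPlane_iff (hfam : IsCurveFamily p P τ ρ) (hE : IsPseudocomplex p P)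
    {z₀ z : Z} {x₀ : X} {y₀ : Y} (hz : z ∈ (chartAt R6 z₀).source)
    (hx : pointMap p τ z ∈ (chartAt R4 x₀).source) (hy : ρ z ∈ (chartAt R4 y₀).source)
    (v : TangentSpace (𝓡 4) (pointMap p τ z)) :
    chartDeriv R4 x₀ (pointMap p τ z) v ∈ pairPlane (localRep R4 R6 (pointMap p τ) z₀ x₀)
      (localRep R4 R6 ρ z₀ y₀) (extChartAt (𝓡 6) z₀ z) ↔ v ∈ curvePlane p P τ z :=
  (mem_pairPlane_localRep (hfam.contMDiff_pointMap hE) hfam.contMDiff hz hx hy v).trans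
    (hfam.mem_curvePlane z v).symm

/-- The kernel of dρ is 2-dimensional and maps onto the 2-dimensional plane of the curve, hence
injectively. -/
theorem transverse (hfam : IsCurveFamily p P τ ρ) (hE : IsPseudocomplex p P) (z : Z)
    (u : TangentSpace (𝓡 6) z) (hu : mfderiv (𝓡 6) (𝓡 4) (pointMap p τ) z u = 0)
    (hu' : mfderiv (𝓡 6) (𝓡 4) ρ z u = 0) : u = 0 := by
  set f : R6 →ₗ[ℝ] R4 := (mfderiv (𝓡 6) (𝓡 4) (pointMap p τ) z).toLinearMap with hf
  set g : R6 →ₗ[ℝ] R4 := (mfderiv (𝓡 6) (𝓡 4) ρ z).toLinearMap with hg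
  have h1 : Module.finrank ℝ (LinearMap.ker g) = 2 :=
    finrank_ker_of_surjective g (hfam.submersion z) finrank_R6 finrank_R4
  have h2 : LinearMap.range (f.domRestrict (LinearMap.ker g)) = curvePlane p P τ z := by
    rw [LinearMap.range_domRestrict]
    exact hfam.tangent z
  have h3 := (f.domRestrict (LinearMap.ker g)).finrank_range_add_finrank_ker
  rw [h1, h2] at h3
  have h4 : Module.finrank ℝ (curvePlane p P τ z) = 2 := hE.finrank_plane (τ z)
  have h5 : LinearMap.ker (f.domRestrict (LinearMap.ker g)) = ⊥ := by
    rw [← Submodule.finrank_eq_zero (R := ℝ)]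
    have h3' : Module.finrank ℝ (curvePlane p P τ z) +
      Module.finrank ℝ (LinearMap.ker (f.domRestrict (LinearMap.ker g))) = 2 := h3
    omega
  have h6 := LinearMap.ker_eq_bot'.1 h5 ⟨u, hu'⟩ hu
  exact congrArg Subtype.val h6

/-- A vector of Θ differs from one tangent to the fibre of the point map by a vector tangent to the
curve, which dρ kills. -/
theorem mem_dualPlane (hfam : IsCurveFamily p P τ ρ) (z : Z) (v : TangentSpace (𝓡 4) (ρ z)) :
    v ∈ dualPlane p P τ ρ z ↔ ∃ u, mfderiv (𝓡 6) (𝓡 4) (pointMap p τ) z u = 0 ∧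
      mfderiv (𝓡 6) (𝓡 4) ρ z u = v := by
  constructor
  · rintro ⟨u, hu, rfl⟩
    obtain ⟨u', hu', huu'⟩ := (hfam.mem_curvePlane z _).1 hu
    refine ⟨u - u', ?_, ?_⟩
    · rw [map_sub, sub_eq_zero]
      exact huu'.symm
    · rw [map_sub, hu', sub_zero]
      rfl
  · rintro ⟨u, hu, rfl⟩
    refine ⟨u, ?_, rfl⟩
    change mfderiv (𝓡 6) (𝓡 4) (pointMap p τ) z u ∈ curvePlane p P τ z
    rw [hu]
    exact Submodule.zero_mem _

theorem finrank_dualPlane (hfam : IsCurveFamily p P τ ρ) (hE : IsPseudocomplex p P) (z : Z) :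
    Module.finrank ℝ (dualPlane p P τ ρ z) = 2 := by
  have h : dualPlane p P τ ρ z =
      (LinearMap.ker (mfderiv (𝓡 6) (𝓡 4) (pointMap p τ) z).toLinearMap).map
        (mfderiv (𝓡 6) (𝓡 4) ρ z).toLinearMap := by
    ext v
    exact hfam.mem_dualPlane z v
  rw [h]
  exact finrank_map_ker (T := R6) (A := R4) (B := R4) _ _ (hfam.surjective_mfderiv_pointMap hE z)
    finrank_R6 finrank_R4 fun u h1 h2 => hfam.transverse hE z u h2 h1

/-- The maps to the points and to the curves, in local coordinates, form an elliptic pair: case of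
the chart centred at the point. -/
theorem ellipticAt_localRep_center (hfam : IsCurveFamily p P τ ρ) (hE : IsPseudocomplex p P)
    {z₀ z : Z} {y₀ : Y} (hz : z ∈ (chartAt R6 z₀).source) (hy : ρ z ∈ (chartAt R4 y₀).source) :
    EllipticAt (localRep R4 R6 (pointMap p τ) z₀ (pointMap p τ z)) (localRep R4 R6 ρ z₀ y₀)
      (extChartAt (𝓡 6) z₀ z) := by
  set x₁ := pointMap p τ z with hx₁
  set κ := extChartAt (𝓡 6) z₀ with hκ
  set L := localRep R4 R6 (pointMap p τ) z₀ x₁ with hLdef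
  set R := localRep R4 R6 ρ z₀ y₀ with hRdef
  have hlams := hfam.contMDiff_pointMap hE
  have hx : pointMap p τ z ∈ (chartAt R4 x₁).source := mem_chart_source R4 x₁
  have hL := contDiffAt_localRep hlams hz hx
  have hR := contDiffAt_localRep hfam.contMDiff hz hy
  have hcond : ∀ᶠ z' in 𝓝 z, z' ∈ (chartAt R6 z₀).source ∧
      pointMap p τ z' ∈ (chartAt R4 x₁).source ∧
      ρ z' ∈ (chartAt R4 y₀).source :=
    (eventually_mem_chart_source hz).and
      ((hlams.continuous.continuousAt.eventually (eventually_mem_chart_source hx)).and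
        (hfam.contMDiff.continuous.continuousAt.eventually (eventually_mem_chart_source hy)))
  have hκc : ContinuousAt κ z := continuousAt_extChartAt' (by simpa using hz)
  have hκsymm : ContinuousAt κ.symm (κ z) := continuousAt_extChartAt_symm'' (by
    exact κ.map_source (by simpa [hκ] using hz))
  have hκz : κ.symm (κ z) = z := κ.left_inv (by simpa [hκ] using hz)
  have hκev : ∀ {Q : Z → Prop}, (∀ᶠ z' in 𝓝 z, Q z') → ∀ᶠ a in 𝓝 (κ z), Q (κ.symm a) := by
    intro Q hQ
    rw [← hκz] at hQ
    exact hκsymm.eventually hQ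
  have hinv : ∀ᶠ a in 𝓝 (κ z), κ (κ.symm a) = a := by
    filter_upwards [(isOpen_extChartAt_target (I := 𝓡 6) z₀).mem_nhds
      (κ.map_source (by simpa [hκ] using hz))] with a ha
    exact κ.right_inv ha
  have hRev : ∀ᶠ a in 𝓝 (κ z), ContDiffAt ℝ ∞ (fderiv ℝ R) a := by
    filter_upwards [hκev hcond, hinv] with a h1 h2
    rw [← h2]
    exact (contDiffAt_localRep hfam.contMDiff h1.1 h1.2.2).fderiv_right (by simp)
  have hLev : ∀ᶠ a in 𝓝 (κ z), ContDiffAt ℝ ∞ (fderiv ℝ L) a := by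
    filter_upwards [hκev hcond, hinv] with a h1 h2
    rw [← h2]
    exact (contDiffAt_localRep hlams h1.1 h1.2.1).fderiv_right (by simp)
  have hRsurj : Function.Surjective (fderiv ℝ R (κ z)) := by
    intro y
    obtain ⟨u, hu⟩ := hfam.submersion z (chartDerivInv R4 y₀ (ρ z) y)
    refine ⟨chartDeriv R6 z₀ z u, ?_⟩
    rw [fderiv_localRep hfam.contMDiff hz hy, hu, chartDeriv_chartDerivInv hy]
  intro v w hv hw hv0 hw0 p' q' hp' hq' hpq
  obtain ⟨x, hxa, hxev⟩ := exists_smooth_section_ker hRev hRsurj hv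
  set s : R6 → R4 := fun a => fderiv ℝ L a (x a) with hs
  have hsd : ∀ᶠ a in 𝓝 (κ z), ContDiffAt ℝ ∞ s a := by
    filter_upwards [hLev, hxev] with a h1 h2
    exact h1.clm_apply h2.2
  have hder : fderiv ℝ s (κ z) w - fderiv ℝ L (κ z) (p' - q') ∈ pairPlane L R (κ z) :=
    fderiv_section_sub_mem hL hR
    (hxev.self_of_nhds.2.differentiableAt (by simp)) (hxev.mono fun a ha => ha.1) (w := w)
    (p := p') (q := q') (by rw [hp', hxa, hL.fderiv_fderiv_symm])
    (by rw [hq', hxa, hR.fderiv_fderiv_symm])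
  -- A degenerate pairing would make the derivative of the section `s` tangent. The rest carries `s`
  -- over to `E` to contradict the ellipticity of the given structure.
  have hder' : fderiv ℝ s (κ z) w ∈ pairPlane L R (κ z) := by
    have h1 : fderiv ℝ L (κ z) (p' - q') ∈ pairPlane L R (κ z) := (map_mem_map_ker_iff _ _ _).2 hpq
    have := Submodule.add_mem _ hder h1
    rwa [sub_add_cancel] at this
  obtain ⟨Φ, hzΦ, hτΦ⟩ := hfam.localDiffeo z
  obtain ⟨N, hN, hNo, hzN⟩ := eventually_nhds_iff.1 (hcond.and
    ((hκc.eventually (hxev.and hsd)).and (Φ.open_source.mem_nhds hzΦ)))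
  set U : Set E := Φ.target ∩ Φ.symm ⁻¹' N with hU
  have hUo : IsOpen U :=
    Φ.symm.contMDiffOn.continuousOn.isOpen_inter_preimage Φ.open_target hNo
  have hmemU : ∀ z' ∈ N, τ z' ∈ U ∧ Φ.symm (τ z') = z' := by
    intro z' hz'
    have h1 := (hN z' hz').2.2
    have h2 : Φ.symm (τ z') = z' := by
      rw [hτΦ h1]
      exact Φ.left_inv h1
    refine ⟨⟨?_, ?_⟩, h2⟩
    · rw [hτΦ h1]
      exact Φ.map_source h1
    · rw [Set.mem_preimage, h2]
      exact hz'
  have hUmem : ∀ e ∈ U, Φ.symm e ∈ N ∧ τ (Φ.symm e) = e := by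
    intro e he
    exact ⟨he.2, (hτΦ (Φ.map_target he.1)).trans (Φ.right_inv he.1)⟩
  -- The local inverse of `τ` transports `s` to a section on an open subset of `E`.
  set S : ∀ e, TangentSpace (𝓡 4) (p e) :=
    fun e => chartDerivInv R4 x₁ (p e) (s (κ (Φ.symm e))) with hS
  have hpU : ∀ e ∈ U, p e ∈ (chartAt R4 x₁).source := by
    intro e he
    obtain ⟨h1, h2⟩ := hUmem e he
    rw [← h2]
    exact (hN _ h1).1.2.1
  have hSz : ∀ z' ∈ N, chartDeriv R4 x₁ (pointMap p τ z') (S (τ z')) = s (κ z') := by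
    intro z' hz'
    rw [hS]
    simp only [(hmemU z' hz').2]
    exact chartDeriv_chartDerivInv (hN z' hz').1.2.1 _
  have hSsec : IsSmoothSectionOn p P S U := by
    refine ⟨contMDiffOn_chartDerivInv hE.contMDiff.contMDiffOn hpU ?_, ?_⟩
    · intro e he
      have h1 := hN _ he.2
      have e1 : ContMDiffAt (𝓡 6) 𝓘(ℝ, R4) ∞ s (κ (Φ.symm e)) := h1.2.1.2.contMDiffAt
      have e2 : ContMDiffAt (𝓡 6) 𝓘(ℝ, R6) ∞ κ (Φ.symm e) := contMDiffAt_extChartAt' h1.1.1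
      have e3 : ContMDiffAt (𝓡 6) (𝓡 6) ∞ Φ.symm e :=
        Φ.symm.contMDiffOn.contMDiffAt (Φ.open_target.mem_nhds he.1)
      exact (e1.comp e (e2.comp e e3)).contMDiffWithinAt
    · intro e he
      obtain ⟨h1, h2⟩ := hUmem e he
      obtain ⟨z', hz', rfl⟩ : ∃ z' ∈ N, τ z' = e := ⟨_, h1, h2⟩
      have h3 := hN z' hz'
      refine (hfam.chartDeriv_mem_pairPlane_iff hE h3.1.1 h3.1.2.1 h3.1.2.2 (S (τ z'))).1 ?_
      rw [hSz z' hz']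
      exact mem_pairPlane.2 ⟨_, h3.2.1.1.1, rfl⟩
  have htriv : ∀ e ∈ U, (trivializationAt R4 (TangentSpace (𝓡 4) : X → Type _) (p (τ z))
      (⟨p e, S e⟩ : TangentBundle (𝓡 4) X)).2 = s (κ (Φ.symm e)) := by
    intro e he
    have h1 := trivializationAt_snd (hpU e he) (S e)
    rw [hS, chartDeriv_chartDerivInv (hpU e he)] at h1
    exact h1
  set w' : TangentSpace (𝓡 6) z := chartDerivInv R6 z₀ z w with hw'
  have hww' : chartDeriv R6 z₀ z w' = w := chartDeriv_chartDerivInv hz w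
  have hvert : vertDeriv p S (τ z) (mfderiv (𝓡 6) (𝓡 6) τ z w') = fderiv ℝ s (κ z) w := by
    rw [vertDeriv]
    set g : E → R4 := fun e => (trivializationAt R4 (TangentSpace (𝓡 4) : X → Type _) (p (τ z))
      (⟨p e, S e⟩ : TangentBundle (𝓡 4) X)).2 with hg
    have hgd : MDifferentiableAt (𝓡 6) 𝓘(ℝ, R4) g (τ z) := by
      have h1 : ContMDiffAt (𝓡 6) 𝓘(ℝ, R4) ∞ g (τ z) :=
        (Bundle.contMDiffAt_totalSpace.1
          ((hSsec.1 _ (hmemU z hzN).1).contMDiffAt (hUo.mem_nhds (hmemU z hzN).1))).2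
      exact h1.mdifferentiableAt (by simp)
    have hcomp := mfderiv_comp z hgd
      (hfam.localDiffeo.contMDiff.mdifferentiableAt (x := z) (by simp))
    have h2 := mfderiv_comp_chart (g := g ∘ τ) (G := s) hz
      (hsd.self_of_nhds.differentiableAt (by simp))
      (by
        filter_upwards [hNo.mem_nhds hzN] with z' hz'
        rw [Function.comp_apply, hg]
        simp only
        rw [htriv _ (hmemU z' hz').1, (hmemU z' hz').2]) w'
    rw [hcomp, hww'] at h2
    exact h2
  refine hE.elliptic (τ z) (mfderiv (𝓡 6) (𝓡 6) τ z w') ?_ ?_ S U hUo (hmemU z hzN).1 hSsec ?_ ?_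
  · refine (hfam.mfderiv_pointMap hE z w').symm.trans ((chartDeriv_eq_zero_iff hx _).1 ?_)
    rw [← fderiv_localRep hlams hz hx, hww']
    exact hw
  · intro h0
    have h1 := (hfam.bijective_mfderiv z).1 (h0.trans (map_zero _).symm)
    rw [h1, map_zero] at hww'
    exact hw0 hww'.symm
  · intro h0
    have h1 : s (κ z) = 0 := (hSz z hzN).symm.trans
      ((congrArg (chartDeriv R4 x₁ (pointMap p τ z)) h0).trans (map_zero _))
    have h2 : chartDeriv R4 x₁ (pointMap p τ z)
      (mfderiv (𝓡 6) (𝓡 4) (pointMap p τ) z (chartDerivInv R6 z₀ z v)) = 0 := by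
      rw [← fderiv_localRep hlams hz hx, chartDeriv_chartDerivInv hz, ← hxa]
      exact h1
    have h3 : chartDeriv R4 y₀ (ρ z) (mfderiv (𝓡 6) (𝓡 4) ρ z (chartDerivInv R6 z₀ z v)) = 0 := by
      rw [← fderiv_localRep hfam.contMDiff hz hy, chartDeriv_chartDerivInv hz]
      exact hv
    rw [chartDeriv_eq_zero_iff hx] at h2
    rw [chartDeriv_eq_zero_iff hy] at h3
    have h4 := hfam.transverse hE z _ h2 h3
    apply hv0
    rw [← chartDeriv_chartDerivInv hz v, h4, map_zero]
  · rw [hvert]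
    refine (hfam.chartDeriv_mem_pairPlane_iff hE hz hx hy _).1 ?_
    -- At its centre the chart has identity derivative, so the coordinate derivative is literally
    -- the vector in `vertDeriv`. This is why the centred chart is treated first.
    exact (congrArg (fun y : R4 => y ∈ pairPlane L R (κ z))
      (chartDeriv_self (pointMap p τ z) (fderiv ℝ s (κ z) w))).mpr hder'

/-- Reduces to the centred chart; `ψ` is the transition map, that is, the identity read in the two
charts. -/
theorem ellipticAt_localRep (hfam : IsCurveFamily p P τ ρ) (hE : IsPseudocomplex p P)
    {z₀ z : Z} {x₀ : X} {y₀ : Y} (hz : z ∈ (chartAt R6 z₀).source)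
    (hx : pointMap p τ z ∈ (chartAt R4 x₀).source) (hy : ρ z ∈ (chartAt R4 y₀).source) :
    EllipticAt (localRep R4 R6 (pointMap p τ) z₀ x₀) (localRep R4 R6 ρ z₀ y₀)
      (extChartAt (𝓡 6) z₀ z) := by
  set x₁ := pointMap p τ z with hx₁def
  have hs := hfam.contMDiff_pointMap hE
  have hx₁ : pointMap p τ z ∈ (chartAt R4 x₁).source := mem_chart_source R4 x₁
  have hL₁z : localRep R4 R6 (pointMap p τ) z₀ x₁ (extChartAt (𝓡 6) z₀ z) =
      extChartAt (𝓡 4) x₁ x₁ := localRep_chart _ x₁ hz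
  refine (hfam.ellipticAt_localRep_center hE hz hy).of_eventuallyEq_comp
    (ψ := localRep R4 R4 (id : X → X) x₁ x₀) (contDiffAt_localRep hs hz hx)
    (contDiffAt_localRep hs hz hx₁) ?_ ?_ ?_
  · rw [hL₁z]
    exact contDiffAt_localRep contMDiff_id hx₁ hx
  · intro y hy0
    rw [hL₁z, ← chartDeriv_chartDerivInv hx₁ y,
      fderiv_localRep (f := (id : X → X)) contMDiff_id hx₁ hx, mfderiv_id] at hy0
    have h1 := (chartDeriv_eq_zero_iff hx _).1 hy0
    rw [← chartDeriv_chartDerivInv hx₁ y, show chartDerivInv R4 x₁ x₁ y = 0 from h1, map_zero]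
  · have hev : ∀ᶠ z' in 𝓝 z, z' ∈ (chartAt R6 z₀).source ∧
        pointMap p τ z' ∈ (chartAt R4 x₁).source :=
      (eventually_mem_chart_source hz).and
        (hs.continuous.continuousAt.eventually (eventually_mem_chart_source hx₁))
    have hzs : z ∈ (extChartAt (𝓡 6) z₀).source := by simpa using hz
    have hcont := continuousAt_extChartAt_symm'' ((extChartAt (𝓡 6) z₀).map_source hzs)
    rw [ContinuousAt, (extChartAt (𝓡 6) z₀).left_inv hzs] at hcont
    filter_upwards [hcont.eventually hev] with a ha
    have h1 : (extChartAt (𝓡 4) x₁).symm (extChartAt (𝓡 4) x₁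
        (pointMap p τ ((extChartAt (𝓡 6) z₀).symm a))) =
        pointMap p τ ((extChartAt (𝓡 6) z₀).symm a) :=
      (extChartAt (𝓡 4) x₁).left_inv (by simpa using ha.2)
    exact congrArg (extChartAt (𝓡 4) x₀) h1.symm

/-- The pairs of charts in which the maps to the points and to the curves are represented. -/
theorem ellipticPairOn_localRep (hfam : IsCurveFamily p P τ ρ) (hE : IsPseudocomplex p P)
    (z₀ : Z) (x₀ : X) (y₀ : Y) :
    EllipticPairOn (localRep R4 R6 (pointMap p τ) z₀ x₀) (localRep R4 R6 ρ z₀ y₀)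
      (extChartAt (𝓡 6) z₀ '' {z | z ∈ (chartAt R6 z₀).source ∧
        pointMap p τ z ∈ (chartAt R4 x₀).source ∧ ρ z ∈ (chartAt R4 y₀).source}) where
  isOpen := by
    have h1 : IsOpen {z | z ∈ (chartAt R6 z₀).source ∧
        pointMap p τ z ∈ (chartAt R4 x₀).source ∧ ρ z ∈ (chartAt R4 y₀).source} :=
      (chartAt R6 z₀).open_source.inter
        (((chartAt R4 x₀).open_source.preimage (hfam.contMDiff_pointMap hE).continuous).inter
          ((chartAt R4 y₀).open_source.preimage hfam.contMDiff.continuous))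
    have h2 := (chartAt R6 z₀).isOpen_image_of_subset_source h1 fun z hz => hz.1
    simpa using h2
  smooth_left := by
    rintro _ ⟨z, hz, rfl⟩
    exact contDiffAt_localRep (hfam.contMDiff_pointMap hE) hz.1 hz.2.1
  smooth_right := by
    rintro _ ⟨z, hz, rfl⟩
    exact contDiffAt_localRep hfam.contMDiff hz.1 hz.2.2
  surjective_left := by
    rintro _ ⟨z, hz, rfl⟩ y
    obtain ⟨u, hu⟩ := hfam.surjective_mfderiv_pointMap hE z (chartDerivInv R4 x₀ _ y)
    refine ⟨chartDeriv R6 z₀ z u, ?_⟩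
    rw [fderiv_localRep (hfam.contMDiff_pointMap hE) hz.1 hz.2.1, hu,
      chartDeriv_chartDerivInv hz.2.1]
  surjective_right := by
    rintro _ ⟨z, hz, rfl⟩ y
    obtain ⟨u, hu⟩ := hfam.submersion z (chartDerivInv R4 y₀ (ρ z) y)
    refine ⟨chartDeriv R6 z₀ z u, ?_⟩
    rw [fderiv_localRep hfam.contMDiff hz.1 hz.2.2, hu, chartDeriv_chartDerivInv hz.2.2]
  transverse := by
    rintro _ ⟨z, hz, rfl⟩ u hu hu'
    rw [← chartDeriv_chartDerivInv hz.1 u] at hu hu' ⊢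
    rw [fderiv_localRep (hfam.contMDiff_pointMap hE) hz.1 hz.2.1,
      chartDeriv_eq_zero_iff hz.2.1] at hu
    rw [fderiv_localRep hfam.contMDiff hz.1 hz.2.2, chartDeriv_eq_zero_iff hz.2.2] at hu'
    rw [hfam.transverse hE z _ hu hu', map_zero]
  elliptic := by
    rintro _ ⟨z, hz, rfl⟩
    exact hfam.ellipticAt_localRep hE hz.1 hz.2.1 hz.2.2

end IsCurveFamily

end Families

/-! ### The dual structure is pseudocomplex. -/

section DualStructure

variable {X : Type*} [TopologicalSpace X] [ChartedSpace R4 X] [IsManifold (𝓡 4) ∞ X]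
variable {E : Type*} [TopologicalSpace E] [ChartedSpace R6 E] [IsManifold (𝓡 6) ∞ E]
variable {Y : Type*} [TopologicalSpace Y] [ChartedSpace R4 Y] [IsManifold (𝓡 4) ∞ Y]
variable {Z : Type*} [TopologicalSpace Z] [ChartedSpace R6 Z] [IsManifold (𝓡 6) ∞ Z]
variable {p : E → X} {P : ∀ e, Submodule ℝ (TangentSpace (𝓡 4) (p e))} {τ : Z → E} {ρ : Z → Y}

namespace IsCurveFamily

theorem chartDeriv_mem_dual_iff (hfam : IsCurveFamily p P τ ρ) (hE : IsPseudocomplex p P)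
    {z₀ z : Z} {x₀ : X} {y₀ : Y} (hz : z ∈ (chartAt R6 z₀).source)
    (hx : pointMap p τ z ∈ (chartAt R4 x₀).source) (hy : ρ z ∈ (chartAt R4 y₀).source)
    (v : TangentSpace (𝓡 4) (ρ z)) :
    chartDeriv R4 y₀ (ρ z) v ∈ pairPlane (localRep R4 R6 ρ z₀ y₀)
      (localRep R4 R6 (pointMap p τ) z₀ x₀) (extChartAt (𝓡 6) z₀ z) ↔ v ∈ dualPlane p P τ ρ z :=
  (mem_pairPlane_localRep hfam.contMDiff (hfam.contMDiff_pointMap hE) hz hy hx v).trans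
    (hfam.mem_dualPlane z v).symm

theorem eventually_chart_sources (hfam : IsCurveFamily p P τ ρ) (hE : IsPseudocomplex p P)
    (z : Z) : ∀ᶠ z' in 𝓝 z, z' ∈ (chartAt R6 z).source ∧
      pointMap p τ z' ∈ (chartAt R4 (pointMap p τ z)).source ∧
      ρ z' ∈ (chartAt R4 (ρ z)).source :=
  (eventually_mem_chart_source (mem_chart_source _ _)).and
    (((hfam.contMDiff_pointMap hE).continuous.continuousAt.eventually
      (eventually_mem_chart_source (mem_chart_source _ _))).and
    (hfam.contMDiff.continuous.continuousAt.eventually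
      (eventually_mem_chart_source (mem_chart_source _ _))))

theorem eventually_of_eventually_chart {z : Z} {Q : R6 → Prop}
    (hQ : ∀ᶠ a in 𝓝 (extChartAt (𝓡 6) z z), Q a) :
    ∀ᶠ z' in 𝓝 z, Q (extChartAt (𝓡 6) z z') :=
  (continuousAt_extChartAt (I := 𝓡 6) z).eventually hQ

theorem eventually_chart_of_eventually {z : Z} {Q : Z → Prop} (hQ : ∀ᶠ z' in 𝓝 z, Q z') :
    ∀ᶠ a in 𝓝 (extChartAt (𝓡 6) z z), Q ((extChartAt (𝓡 6) z).symm a) := by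
  have h := continuousAt_extChartAt_symm (I := 𝓡 6) z
  rw [ContinuousAt, extChartAt_to_inv] at h
  exact h.eventually hQ

theorem isSmoothPlaneField_dual (hfam : IsCurveFamily p P τ ρ) (hE : IsPseudocomplex p P) :
    IsSmoothPlaneField ρ (dualPlane p P τ ρ) := by
  intro z₀
  set κ := extChartAt (𝓡 6) z₀ with hκ
  set L := localRep R4 R6 (pointMap p τ) z₀ (pointMap p τ z₀) with hL
  set R := localRep R4 R6 ρ z₀ (ρ z₀) with hR
  have h := hfam.ellipticPairOn_localRep hE z₀ (pointMap p τ z₀) (ρ z₀)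
  have hmem : κ z₀ ∈ κ '' {z | z ∈ (chartAt R6 z₀).source ∧
      pointMap p τ z ∈ (chartAt R4 (pointMap p τ z₀)).source ∧
      ρ z ∈ (chartAt R4 (ρ z₀)).source} :=
    ⟨z₀, (hfam.eventually_chart_sources hE z₀).self_of_nhds, rfl⟩
  have hfr : Module.finrank ℝ (pairPlane R L (κ z₀)) = 2 :=
    h.symm.finrank_pairPlane finrank_R6 finrank_R4 hmem
  -- A basis at the centre lifts to ker dL and extends to kernel sections. Their images stay
  -- independent nearby, and by dimension they span the dual planes.
  set b := Module.finBasisOfFinrankEq ℝ (pairPlane R L (κ z₀)) hfr with hb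
  obtain ⟨w₀, hw₀, hbw₀⟩ := mem_pairPlane.1 (b 0).2
  obtain ⟨w₁, hw₁, hbw₁⟩ := mem_pairPlane.1 (b 1).2
  obtain ⟨x₀, hx₀, hxev₀⟩ := h.symm.exists_section hmem hw₀
  obtain ⟨x₁, hx₁, hxev₁⟩ := h.symm.exists_section hmem hw₁
  set g₀ : R6 → R4 := fun a => fderiv ℝ R a (x₀ a) with hg₀
  set g₁ : R6 → R4 := fun a => fderiv ℝ R a (x₁ a) with hg₁
  have hRs := h.symm.eventually_contDiffAt_fderiv_left hmem
  have hgs : ∀ᶠ a in 𝓝 (κ z₀), ContDiffAt ℝ ∞ g₀ a ∧ ContDiffAt ℝ ∞ g₁ a := by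
    filter_upwards [hRs, hxev₀, hxev₁] with a h1 h2 h3
    exact ⟨h1.clm_apply h2.2, h1.clm_apply h3.2⟩
  have hli : ∀ᶠ a in 𝓝 (κ z₀), LinearIndependent ℝ ![g₀ a, g₁ a] := by
    have hc : ContinuousAt (fun a => ![g₀ a, g₁ a]) (κ z₀) := by
      rw [continuousAt_pi]
      intro i
      fin_cases i
      · exact hgs.self_of_nhds.1.continuousAt
      · exact hgs.self_of_nhds.2.continuousAt
    refine hc.eventually_mem (s := {f | LinearIndependent ℝ f})
      (isOpen_setOfPred_linearIndependent.mem_nhds ?_)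
    have h1 := b.linearIndependent.map' (pairPlane R L (κ z₀)).subtype (Submodule.ker_subtype _)
    rw [Set.mem_ofPred_eq]
    convert! h1 using 1
    ext i : 1
    fin_cases i
    · simp only [hg₀, hx₀]
      exact hbw₀
    · simp only [hg₁, hx₁]
      exact hbw₁
  obtain ⟨U, hU, hUo, hzU⟩ := eventually_nhds_iff.1 ((hfam.eventually_chart_sources hE z₀).and
    (eventually_of_eventually_chart (hgs.and (hli.and (hxev₀.and hxev₁)))))
  have hsec : ∀ (x : R6 → R6) (G : R6 → R4), (∀ a, G a = fderiv ℝ R a (x a)) →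
      (∀ z ∈ U, ContDiffAt ℝ ∞ G (κ z)) → (∀ z ∈ U, fderiv ℝ L (κ z) (x (κ z)) = 0) →
      IsSmoothSectionOn ρ (dualPlane p P τ ρ)
        (fun z => chartDerivInv R4 (ρ z₀) (ρ z) (G (κ z))) U := by
    intro x G hG hGs hx
    refine ⟨contMDiffOn_chartDerivInv hfam.contMDiff.contMDiffOn (fun z hz => (hU z hz).1.2.2) ?_,
      ?_⟩
    · intro z hz
      have e1 : ContMDiffAt (𝓡 6) 𝓘(ℝ, R4) ∞ G (κ z) := (hGs z hz).contMDiffAt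
      have e2 : ContMDiffAt (𝓡 6) 𝓘(ℝ, R6) ∞ κ z := contMDiffAt_extChartAt' (hU z hz).1.1
      exact (e1.comp z e2).contMDiffWithinAt
    · intro z hz
      obtain ⟨h1, h2, h3⟩ := (hU z hz).1
      rw [← hfam.chartDeriv_mem_dual_iff hE h1 h2 h3, chartDeriv_chartDerivInv h3, hG]
      exact mem_pairPlane.2 ⟨_, hx z hz, rfl⟩
  have hsec₀ := hsec x₀ g₀ (fun _ => rfl) (fun z hz => (hU z hz).2.1.1)
    (fun z hz => (hU z hz).2.2.2.1.1)
  have hsec₁ := hsec x₁ g₁ (fun _ => rfl) (fun z hz => (hU z hz).2.1.2)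
    (fun z hz => (hU z hz).2.2.2.2.1)
  refine ⟨U, hUo, hzU, _, _, hsec₀, hsec₁, fun z hz => ?_⟩
  have hρ := (hU z hz).1.2.2
  have hli' : LinearIndependent ℝ ![chartDerivInv R4 (ρ z₀) (ρ z) (g₀ (κ z)),
      chartDerivInv R4 (ρ z₀) (ρ z) (g₁ (κ z))] := by
    have h1 := (hU z hz).2.2.1
    have h2 := h1.map' (chartDerivInv R4 (ρ z₀) (ρ z)).toLinearMap (by
      rw [LinearMap.ker_eq_bot']
      intro y hy
      have := congrArg (chartDeriv R4 (ρ z₀) (ρ z)) hy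
      rw [map_zero] at this
      rw [← this]
      exact (chartDeriv_chartDerivInv hρ y).symm)
    convert! h2 using 1
    ext i : 1
    fin_cases i <;> rfl
  have : FiniteDimensional ℝ (dualPlane p P τ ρ z) :=
    Module.finite_of_finrank_pos (by rw [hfam.finrank_dualPlane hE z]; norm_num)
  refine ⟨hli', ?_⟩
  refine Submodule.eq_of_le_of_finrank_eq ?_ ?_
  · rw [Submodule.span_le]
    rintro v (rfl | rfl)
    · exact hsec₀.2 z hz
    · exact hsec₁.2 z hz
  · rw [hfam.finrank_dualPlane hE z]
    have h1 := finrank_span_eq_card hli'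
    rw [Matrix.range_cons, Matrix.range_cons, Matrix.range_empty, Set.union_empty,
      Set.singleton_union] at h1
    simpa using h1

/-- In charts a section of the dual planes is a section of dR(ker dL), so `fderiv_section_notMem`
applies to the pair with its maps exchanged. -/
theorem isEllipticFamily_dual (hfam : IsCurveFamily p P τ ρ) (hE : IsPseudocomplex p P) :
    IsEllipticFamily ρ (dualPlane p P τ ρ) := by
  intro z₀ w hw hw0 s U hUo hzU hs hs0 hmemP
  set κ := extChartAt (𝓡 6) z₀ with hκ
  set L := localRep R4 R6 (pointMap p τ) z₀ (pointMap p τ z₀) with hL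
  set R := localRep R4 R6 ρ z₀ (ρ z₀) with hR
  have hsrc := hfam.eventually_chart_sources hE z₀
  obtain ⟨hz, hx, hy⟩ := hsrc.self_of_nhds
  have h := hfam.ellipticPairOn_localRep hE z₀ (pointMap p τ z₀) (ρ z₀)
  have hmem : κ z₀ ∈ κ '' {z | z ∈ (chartAt R6 z₀).source ∧
      pointMap p τ z ∈ (chartAt R4 (pointMap p τ z₀)).source ∧
      ρ z ∈ (chartAt R4 (ρ z₀)).source} := ⟨z₀, hsrc.self_of_nhds, rfl⟩
  set g : Z → R4 := fun z => (trivializationAt R4 (TangentSpace (𝓡 4) : Y → Type _) (ρ z₀)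
    (⟨ρ z, s z⟩ : TangentBundle (𝓡 4) Y)).2 with hg
  have hgs : ContMDiffAt (𝓡 6) 𝓘(ℝ, R4) ∞ g z₀ :=
    (Bundle.contMDiffAt_totalSpace.1 ((hs.1 z₀ hzU).contMDiffAt (hUo.mem_nhds hzU))).2
  set G : R6 → R4 := g ∘ κ.symm with hG
  have hGd : DifferentiableAt ℝ G (κ z₀) := by
    have h1 := contMDiffAt_iff_source.1 hgs
    have h2 : ContDiffAt ℝ ∞ G (κ z₀) := by simpa using! h1.contDiffWithinAt
    exact h2.differentiableAt (by simp)
  have hgtriv : ∀ z, ρ z ∈ (chartAt R4 (ρ z₀)).source → g z = chartDeriv R4 (ρ z₀) (ρ z) (s z) :=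
    fun z hz => trivializationAt_snd hz (s z)
  have hGκ : ∀ᶠ z in 𝓝 z₀, g z = G (κ z) := by
    filter_upwards [hsrc] with z hz
    rw [hG, Function.comp_apply, κ.left_inv (by simpa [hκ] using hz.1)]
  have hGP : ∀ᶠ a in 𝓝 (κ z₀), G a ∈ pairPlane R L a := by
    have h1 : ∀ᶠ a in 𝓝 (κ z₀), κ (κ.symm a) = a := by
      filter_upwards [extChartAt_target_mem_nhds (I := 𝓡 6) z₀] with a ha
      exact κ.right_inv ha
    filter_upwards [eventually_chart_of_eventually (hsrc.and (hUo.mem_nhds hzU)), h1] with a ha ha'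
    obtain ⟨⟨h2, h3, h4⟩, h5⟩ := ha
    have h6 := (hfam.chartDeriv_mem_dual_iff hE h2 h3 h4 _).2 (hs.2 _ h5)
    rw [← hgtriv _ h4] at h6
    rwa [ha'] at h6
  have hdG : vertDeriv ρ s z₀ w = fderiv ℝ G (κ z₀) (chartDeriv R6 z₀ z₀ w) :=
    mfderiv_comp_chart (g := g) hz hGd hGκ w
  refine h.symm.fderiv_section_notMem hmem hGP hGd ?_ (w := chartDeriv R6 z₀ z₀ w) ?_ ?_ ?_
  · rw [← hGκ.self_of_nhds, hgtriv z₀ hy]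
    exact fun h0 => hs0 ((chartDeriv_eq_zero_iff hy _).1 h0)
  · rw [fderiv_localRep hfam.contMDiff hz hy, hw, map_zero]
  · exact fun h0 => hw0 ((chartDeriv_eq_zero_iff hz _).1 h0)
  · have h1 := (hfam.chartDeriv_mem_dual_iff hE hz hx hy _).2 hmemP
    rw [chartDeriv_self, hdG] at h1
    exact h1

theorem isPseudocomplex_dual (hfam : IsCurveFamily p P τ ρ) (hE : IsPseudocomplex p P) :
    IsPseudocomplex ρ (dualPlane p P τ ρ) :=
  ⟨hfam.contMDiff, hfam.submersion, hfam.isSmoothPlaneField_dual hE, hfam.isEllipticFamily_dual hE⟩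

end IsCurveFamily

end DualStructure

/-! ### Almost complex structures in charts, and back to manifolds. -/

section AlmostComplex

variable {M : Type*} [TopologicalSpace M] [ChartedSpace R4 M] [IsManifold (𝓡 4) ∞ M]
variable {M' : Type*} [TopologicalSpace M'] [ChartedSpace R4 M'] [IsManifold (𝓡 4) ∞ M']
variable {N : Type*} [TopologicalSpace N] [ChartedSpace R6 N] [IsManifold (𝓡 6) ∞ N]

/-- A field of endomorphisms of the tangent spaces, read in the chart centred at `x₀`. -/
def endomorphismRep (J : ∀ x : M, TangentSpace (𝓡 4) x →L[ℝ] TangentSpace (𝓡 4) x) (x₀ : M)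
    (u : R4) : R4 →L[ℝ] R4 :=
  ContinuousLinearMap.inCoordinates R4 (TangentSpace (𝓡 4) : M → Type _) R4
    (TangentSpace (𝓡 4) : M → Type _) x₀ ((extChartAt (𝓡 4) x₀).symm u) x₀
    ((extChartAt (𝓡 4) x₀).symm u) (J ((extChartAt (𝓡 4) x₀).symm u))

theorem endomorphismRep_chart
    (J : ∀ x : M, TangentSpace (𝓡 4) x →L[ℝ] TangentSpace (𝓡 4) x) {x₀ x : M}
    (hx : x ∈ (chartAt R4 x₀).source) (v : TangentSpace (𝓡 4) x) :
    endomorphismRep J x₀ (extChartAt (𝓡 4) x₀ x) (chartDeriv R4 x₀ x v) =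
      chartDeriv R4 x₀ x (J x v) := by
  have : IsManifold 𝓘(ℝ, R4) 1 M := IsManifold.of_le (n := ∞) (by simp)
  have hinv : (extChartAt (𝓡 4) x₀).symm (extChartAt (𝓡 4) x₀ x) = x :=
    (extChartAt (𝓡 4) x₀).left_inv (by simpa using hx)
  have hbase : x ∈ (trivializationAt R4 (TangentSpace (𝓡 4) : M → Type _) x₀).baseSet := by
    simpa using hx
  have hcl := TangentBundle.continuousLinearMapAt_trivializationAt (I := 𝓡 4) hx
  rw [endomorphismRep, hinv]
  have h1 : chartDeriv R4 x₀ x =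
      (trivializationAt R4 (TangentSpace (𝓡 4) : M → Type _) x₀).continuousLinearMapAt ℝ x :=
    hcl.symm
  rw [h1, ContinuousLinearMap.inCoordinates]
  simp only [ContinuousLinearMap.comp_apply]
  rw [Bundle.Trivialization.symmL_continuousLinearMapAt _ hbase]

theorem eventually_differentiableAt_endomorphismRep
    {J : ∀ x : M, TangentSpace (𝓡 4) x →L[ℝ] TangentSpace (𝓡 4) x} {W : Set M}
    (hJ : IsAlmostComplexStructureOn J W) {x₀ : M} (hW : W ∈ 𝓝 x₀) :
    ∀ᶠ u in 𝓝 (extChartAt (𝓡 4) x₀ x₀), DifferentiableAt ℝ (endomorphismRep J x₀) u := by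
  have h1 := (contMDiffAt_hom_bundle _).1 (hJ.smooth.contMDiffAt hW)
  have h2 := contMDiffAt_iff_source.1 h1.2
  have h3 : ContDiffAt ℝ ∞ (endomorphismRep J x₀) (extChartAt (𝓡 4) x₀ x₀) := by
    simpa using! h2.contDiffWithinAt
  exact ((h3.of_le (m := 1) (by simp)).eventually (by simp)).mono fun u hu =>
    hu.differentiableAt (by simp)

/-- Submersions are open. Smoothness of an almost complex structure on the image of an open set is
therefore smoothness on a neighbourhood of each image point. -/
theorem image_mem_nhds_of_surjective_mfderiv {f : N → M} (hf : ContMDiff (𝓡 6) (𝓡 4) ∞ f)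
    {z₀ : N} (hsurj : Function.Surjective (mfderiv (𝓡 6) (𝓡 4) f z₀)) {U : Set N}
    (hU : U ∈ 𝓝 z₀) : f '' U ∈ 𝓝 (f z₀) := by
  set κ := extChartAt (𝓡 6) z₀ with hκ
  set χ := extChartAt (𝓡 4) (f z₀) with hχ
  set L := localRep R4 R6 f z₀ (f z₀) with hL
  have hz := mem_chart_source R6 z₀
  have hx := mem_chart_source R4 (f z₀)
  have hLs := contDiffAt_localRep hf hz hx
  have hLsurj : Function.Surjective (fderiv ℝ L (κ z₀)) := by
    intro y
    obtain ⟨u, hu⟩ := hsurj (chartDerivInv R4 (f z₀) (f z₀) y)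
    refine ⟨chartDeriv R6 z₀ z₀ u, ?_⟩
    rw [fderiv_localRep hf hz hx, hu, chartDeriv_chartDerivInv hx]
  have hmap := (hLs.hasStrictFDerivAt (by simp)).map_nhds_eq_of_surj
    (LinearMap.range_eq_top.2 hLsurj)
  have hLz : L (κ z₀) = χ (f z₀) := localRep_chart f (f z₀) hz
  have hev : ∀ᶠ z in 𝓝 z₀, z ∈ U ∧ f z ∈ (chartAt R4 (f z₀)).source :=
    (Filter.eventually_mem_set.2 hU).and
      (hf.continuous.continuousAt.eventually (eventually_mem_chart_source hx))
  have hA := IsCurveFamily.eventually_chart_of_eventually hev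
  have himg : L '' {a | κ.symm a ∈ U ∧ f (κ.symm a) ∈ (chartAt R4 (f z₀)).source} ∈
      𝓝 (χ (f z₀)) := by
    rw [← hLz, ← hmap]
    exact Filter.image_mem_map hA
  have hχc : ContinuousAt χ (f z₀) := continuousAt_extChartAt (f z₀)
  filter_upwards [hχc.eventually himg, eventually_mem_chart_source hx] with x hx1 hx2
  obtain ⟨a, ⟨ha, ha'⟩, hax⟩ := hx1
  refine ⟨κ.symm a, ha, ?_⟩
  exact χ.injOn (by simpa [hχ] using ha') (by simpa [hχ] using hx2) hax

/-- If the planes `df (ker dg)` are complex lines, then they are so in local coordinates. -/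
theorem eventually_isComplexPair {f : N → M} {g : N → M'} (hf : ContMDiff (𝓡 6) (𝓡 4) ∞ f)
    (hg : ContMDiff (𝓡 6) (𝓡 4) ∞ g) {U : Set N} (hU : IsOpen U) {z₀ : N} (hz₀ : z₀ ∈ U)
    (hsurj : Function.Surjective (mfderiv (𝓡 6) (𝓡 4) f z₀))
    {J : ∀ x : M, TangentSpace (𝓡 4) x →L[ℝ] TangentSpace (𝓡 4) x}
    (hJ : IsAlmostComplexStructureOn J (f '' U))
    (hP : ∀ z ∈ U, ∀ u, mfderiv (𝓡 6) (𝓡 4) g z u = 0 → ∃ u', mfderiv (𝓡 6) (𝓡 4) g z u' = 0 ∧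
      mfderiv (𝓡 6) (𝓡 4) f z u' = J (f z) (mfderiv (𝓡 6) (𝓡 4) f z u)) :
    ∀ᶠ z in 𝓝 z₀, IsComplexPair (localRep R4 R6 f z₀ (f z₀)) (localRep R4 R6 g z₀ (g z₀))
      {extChartAt (𝓡 6) z₀ z} (endomorphismRep J (f z₀)) := by
  have hz := mem_chart_source R6 z₀
  have hx := mem_chart_source R4 (f z₀)
  have hy := mem_chart_source R4 (g z₀)
  have hd := eventually_differentiableAt_endomorphismRep hJ
    (image_mem_nhds_of_surjective_mfderiv hf hsurj (hU.mem_nhds hz₀))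
  have hfc : ContinuousAt (fun z => extChartAt (𝓡 4) (f z₀) (f z)) z₀ :=
    (continuousAt_extChartAt (I := 𝓡 4) (f z₀)).comp hf.continuous.continuousAt
  filter_upwards [hU.mem_nhds hz₀, eventually_mem_chart_source hz,
    hf.continuous.continuousAt.eventually (eventually_mem_chart_source hx),
    hg.continuous.continuousAt.eventually (eventually_mem_chart_source hy),
    hfc.eventually hd] with z hzU hz hx hy hdz
  have hL := localRep_chart (V := R4) f (f z₀) hz
  refine ⟨?_, ?_, ?_⟩
  · rintro _ rfl
    rw [hL]
    exact hdz
  · rintro _ rfl y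
    rw [hL, ← chartDeriv_chartDerivInv hx y, endomorphismRep_chart J hx, endomorphismRep_chart J hx,
      hJ.sq_eq_neg_one _ ⟨z, hzU, rfl⟩, map_neg]
  · rintro _ rfl y hyP
    rw [hL, ← chartDeriv_chartDerivInv hx y, endomorphismRep_chart J hx,
      mem_pairPlane_localRep hf hg hz hx hy]
    rw [← chartDeriv_chartDerivInv hx y, mem_pairPlane_localRep hf hg hz hx hy] at hyP
    obtain ⟨u, hu, hfu⟩ := hyP
    rw [← hfu]
    exact hP z hzU u hu

theorem isComplexStructureOn_of_local_coordinates
    {J : ∀ x : M, TangentSpace (𝓡 4) x →L[ℝ] TangentSpace (𝓡 4) x} {W : Set M}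
    (hJ : IsAlmostComplexStructureOn J W)
    (hφ : ∀ x₀ ∈ W, ∃ φ : R4 → ℂ × ℂ, (∀ᶠ u in 𝓝 (extChartAt (𝓡 4) x₀ x₀), ContDiffAt ℝ ∞ φ u ∧
      ∀ ξ, fderiv ℝ φ u (endomorphismRep J x₀ u ξ) = Complex.I • fderiv ℝ φ u ξ) ∧
      ∀ ξ, fderiv ℝ φ (extChartAt (𝓡 4) x₀ x₀) ξ = 0 → ξ = 0) :
    IsComplexStructureOn J W := by
  refine ⟨hJ, fun x₀ hx₀ => ?_⟩
  obtain ⟨φ, hev, hinj⟩ := hφ x₀ hx₀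
  set χ := extChartAt (𝓡 4) x₀ with hχ
  refine ⟨φ ∘ χ, ?_, ?_⟩
  · obtain ⟨Φ, hΦ, hsrc, hs, hs'⟩ := exists_smooth_localInverse (hev.mono fun u hu => hu.1) hinj
      (by simp)
    refine ⟨⟨((chartAt R4 x₀).trans Φ).toPartialEquiv, ((chartAt R4 x₀).trans Φ).open_source,
      ((chartAt R4 x₀).trans Φ).open_target, ?_, ?_⟩, ?_, ?_⟩
    · intro x hx
      have hx' : x ∈ (chartAt R4 x₀).source ∧ chartAt R4 x₀ x ∈ Φ.source := by
        simpa using! hx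
      have e1 : ContMDiffAt (𝓡 4) (𝓡 4) ∞ (chartAt R4 x₀) x :=
        contMDiffOn_chart.contMDiffAt ((chartAt R4 x₀).open_source.mem_nhds hx'.1)
      have e2 : ContMDiffAt (𝓡 4) 𝓘(ℝ, ℂ × ℂ) ∞ Φ (chartAt R4 x₀ x) := by
        rw [hΦ]
        exact (hs _ hx'.2).contMDiffAt
      exact (e2.comp x e1).contMDiffWithinAt
    · intro y hy
      have hy' : y ∈ Φ.target ∧ Φ.symm y ∈ (chartAt R4 x₀).target := by
        simpa using! hy
      have e1 : ContMDiffAt (𝓡 4) (𝓡 4) ∞ (chartAt R4 x₀).symm (Φ.symm y) :=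
        contMDiffOn_chart_symm.contMDiffAt ((chartAt R4 x₀).open_target.mem_nhds hy'.2)
      have e2 : ContMDiffAt 𝓘(ℝ, ℂ × ℂ) (𝓡 4) ∞ Φ.symm y := (hs' _ hy'.1).contMDiffAt
      exact (e1.comp y e2).contMDiffWithinAt
    · change x₀ ∈ ((chartAt R4 x₀).trans Φ).source
      rw [OpenPartialHomeomorph.trans_source]
      exact ⟨mem_chart_source R4 x₀, by simpa [hχ] using hsrc⟩
    · intro x hx
      change φ (χ x) = Φ (chartAt R4 x₀ x)
      rw [hΦ]
      simp [hχ]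
  · have hcont : ContinuousAt χ x₀ := continuousAt_extChartAt x₀
    filter_upwards [hcont.eventually hev, eventually_mem_chart_source (mem_chart_source R4 x₀)]
      with x hx hxs v
    have hd : ∀ v, coordDeriv (φ ∘ χ) x v = fderiv ℝ φ (χ x) (chartDeriv R4 x₀ x v) := fun v =>
      mfderiv_comp_chart hxs (hx.1.differentiableAt (by simp))
        (Filter.Eventually.of_forall fun _ => rfl) v
    rw [hd, hd, ← endomorphismRep_chart J hxs, hx.2]

end AlmostComplex

/-! ### Simultaneous local models and the theorem. -/

section Main

variable {X : Type*} [TopologicalSpace X] [ChartedSpace R4 X] [IsManifold (𝓡 4) ∞ X]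
variable {E : Type*} [TopologicalSpace E] [ChartedSpace R6 E] [IsManifold (𝓡 6) ∞ E]
variable {Y : Type*} [TopologicalSpace Y] [ChartedSpace R4 Y] [IsManifold (𝓡 4) ∞ Y]
variable {Z : Type*} [TopologicalSpace Z] [ChartedSpace R6 Z] [IsManifold (𝓡 6) ∞ Z]
variable {p : E → X} {P : ∀ e, Submodule ℝ (TangentSpace (𝓡 4) (p e))} {τ : Z → E} {ρ : Z → Y}

theorem IsComplexPair.of_singletons {T A B : Type*} [NormedAddCommGroup T] [NormedSpace ℝ T]
    [NormedAddCommGroup A] [NormedSpace ℝ A] [NormedAddCommGroup B] [NormedSpace ℝ B]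
    {L : T → A} {R : T → B} {O : Set T} {j : A → A →L[ℝ] A}
    (h : ∀ a ∈ O, IsComplexPair L R {a} j) : IsComplexPair L R O j :=
  ⟨fun a ha => (h a ha).differentiableAt a rfl, fun a ha => (h a ha).sq_eq_neg a rfl,
    fun a ha => (h a ha).map_mem a rfl⟩

/-- Around each pointed curve there are charts in which both almost complex structures are
represented. -/
theorem IsCurveFamily.exists_local_complexPair (hfam : IsCurveFamily p P τ ρ)
    (hE : IsPseudocomplex p P) {U : Set Z} (hU : IsOpen U)
    {JX : ∀ x : X, TangentSpace (𝓡 4) x →L[ℝ] TangentSpace (𝓡 4) x}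
    {JY : ∀ y : Y, TangentSpace (𝓡 4) y →L[ℝ] TangentSpace (𝓡 4) y}
    (hX : IsAlmostComplexOver (pointMap p τ) (curvePlane p P τ) U JX)
    (hY : IsAlmostComplexOver ρ (dualPlane p P τ ρ) U JY) {z : Z} (hz : z ∈ U) :
    ∃ O : Set R6, extChartAt (𝓡 6) z z ∈ O ∧
      EllipticPairOn (localRep R4 R6 (pointMap p τ) z (pointMap p τ z))
        (localRep R4 R6 ρ z (ρ z)) O ∧
      IsComplexPair (localRep R4 R6 (pointMap p τ) z (pointMap p τ z))
        (localRep R4 R6 ρ z (ρ z)) O (endomorphismRep JX (pointMap p τ z)) ∧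
      IsComplexPair (localRep R4 R6 ρ z (ρ z))
        (localRep R4 R6 (pointMap p τ) z (pointMap p τ z)) O (endomorphismRep JY (ρ z)) := by
  have h := hfam.ellipticPairOn_localRep hE z (pointMap p τ z) (ρ z)
  have hjX := eventually_isComplexPair (hfam.contMDiff_pointMap hE) hfam.contMDiff hU hz
    (hfam.surjective_mfderiv_pointMap hE z) hX.1 (fun z' hz' u hu =>
      (hfam.mem_curvePlane z' _).1 (hX.2 z' hz' _ ((hfam.mem_curvePlane z' _).2 ⟨u, hu, rfl⟩)))
  have hjY := eventually_isComplexPair hfam.contMDiff (hfam.contMDiff_pointMap hE) hU hz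
    (hfam.submersion z) hY.1 (fun z' hz' u hu =>
      (hfam.mem_dualPlane z' _).1 (hY.2 z' hz' _ ((hfam.mem_dualPlane z' _).2 ⟨u, hu, rfl⟩)))
  obtain ⟨N, hN, hNo, hzN⟩ := eventually_nhds_iff.1
    ((hfam.eventually_chart_sources hE z).and (hjX.and hjY))
  have hopen : IsOpen (extChartAt (𝓡 6) z '' N) := by
    have h2 := (chartAt R6 z).isOpen_image_of_subset_source hNo fun z' hz' => (hN z' hz').1.1
    simpa using h2
  refine ⟨extChartAt (𝓡 6) z '' N, ⟨z, hzN, rfl⟩,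
    h.mono hopen (Set.image_mono fun z' hz' => (hN z' hz').1),
    IsComplexPair.of_singletons ?_, IsComplexPair.of_singletons ?_⟩
  · rintro _ ⟨z', hz', rfl⟩
    exact (hN z' hz').2.1
  · rintro _ ⟨z', hz', rfl⟩
    exact (hN z' hz').2.2

end Main

end

theorem mainTheorem1
    {X : Type*} [TopologicalSpace X] [ChartedSpace R4 X] [IsManifold (𝓡 4) ∞ X]
    {E : Type*} [TopologicalSpace E] [ChartedSpace R6 E] [IsManifold (𝓡 6) ∞ E]
    {Y : Type*} [TopologicalSpace Y] [ChartedSpace R4 Y] [IsManifold (𝓡 4) ∞ Y]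
    {Z : Type*} [TopologicalSpace Z] [ChartedSpace R6 Z] [IsManifold (𝓡 6) ∞ Z]
    (p : E → X) (P : ∀ e, Submodule ℝ (TangentSpace (𝓡 4) (p e)))
    (hE : IsPseudocomplex p P)
    (τ : Z → E) (ρ : Z → Y) (hfam : IsCurveFamily p P τ ρ) :
    IsPseudocomplex ρ (dualPlane p P τ ρ) ∧
    ∀ (U : Set Z), IsOpen U →
      ∀ (JX : ∀ x : X, TangentSpace (𝓡 4) x →L[ℝ] TangentSpace (𝓡 4) x)
        (JY : ∀ y : Y, TangentSpace (𝓡 4) y →L[ℝ] TangentSpace (𝓡 4) y),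
        IsAlmostComplexOver (pointMap p τ) (curvePlane p P τ) U JX →
        IsAlmostComplexOver ρ (dualPlane p P τ ρ) U JY →
        IsComplexStructureOn JX (pointMap p τ '' U) ∧ IsComplexStructureOn JY (ρ '' U) := by
  refine ⟨hfam.isPseudocomplex_dual hE, fun U hU JX JY hX hY => ⟨?_, ?_⟩⟩
  · refine isComplexStructureOn_of_local_coordinates hX.1 ?_
    rintro _ ⟨z, hz, rfl⟩
    obtain ⟨O, hzO, h, hjX, hjY⟩ := hfam.exists_local_complexPair hE hU hX hY hz
    have := h.exists_holomorphic_coordinates finrank_R6 finrank_R4 finrank_R4 hjX hjY hzO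
    rwa [localRep_chart (pointMap p τ) _ (mem_chart_source R6 z)] at this
  · refine isComplexStructureOn_of_local_coordinates hY.1 ?_
    rintro _ ⟨z, hz, rfl⟩
    obtain ⟨O, hzO, h, hjX, hjY⟩ := hfam.exists_local_complexPair hE hU hX hY hz
    -- Points and curves exchange roles: the pencils now consist of the points on a given curve.
    have := h.symm.exists_holomorphic_coordinates finrank_R6 finrank_R4 finrank_R4 hjY hjX hzO
    rwa [localRep_chart ρ _ (mem_chart_source R6 z)] at this
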